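/- Let $G$ be a torus, i.e. a topological group isomorphic to $(S^1)^r$ for some $r\ge 0$, and let $K$ be a connected subgroup of $G$. Let $$S^{\infty V(K)}=\bigcup_{V^K=0}S^V ,$$ where $V$ runs over the finite-dimensional subrepresentations of the complete $G$-universe $\mathcal U=\bigoplus_{\chi}\mathbb C_\chi^{\oplus\mathbb N}$ ($\chi$ ranging over all characters $G\to S^1$) with $V^K=0$, where $S^V$ is the one-point compactification of $V$, based at the common point at infinity, and where the union has the colimit topology. Then the based $G$-space $S^{\infty V(K)}$ is an $E_\infty^G$-algebra; that is, there is an $E_\infty^G$-operad $\mathcal O$ such that $S^{\infty V(K)}$ is an algebra over $\mathcal O$, with structure maps $\mathcal O(n)_+\wedge (S^{\infty V(K)})^{\wedge n}\to S^{\infty V(K)}$. Here an $E_\infty^G$-operad is a symmetric operad $\mathcal O$ in (compactly generated weak Hausdorff) $G$-spaces such that, for every $n\ge 0$, $\mathcal O(n)$ is a universal space for the family $\mathcal F_G(n)=\{\Gamma \mid \Gamma\cap\Sigma_n=1\}$ of closed subgroups of $G\times\Sigma_n$: for every closed subgroup $\Gamma\subseteq G\times\Sigma_n$, the fixed point space $\mathcal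 O(n)^\Gamma$ is contractible if $\Gamma\cap\Sigma_n=1$, and empty otherwise. -/

import Mathlib

universe u

open Topology OnePoint

/-! ### Compactly generated `G`-spaces -/

/-- A torus: a topological group isomorphic to `(S¹)^r` for some `r ≥ 0`. -/
class IsTorus (G : Type u) [Group G] [TopologicalSpace G] : Prop where
  exists_equiv : ∃ r : ℕ, Nonempty (G ≃ₜ* (Fin r → Circle))

/-- A space is weakly Hausdorff if every continuous image of a compact Hausdorff space is closed. -/
def IsWeaklyHausdorff (X : Type u) [TopologicalSpace X] : Prop :=
  ∀ (T : Type u) [TopologicalSpace T] [CompactSpace T] [T2Space T] (f : T → X),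
    Continuous f → IsClosed (Set.range f)

/-- Continuity for the compactly generated topology (`k`-ification) on the source. For a source that
is a product of compactly generated spaces, this is continuity on their product in the category of
compactly generated spaces. -/
def KContinuous {X Z : Type u} [TopologicalSpace X] [t : TopologicalSpace Z] (f : X → Z) : Prop :=
  Continuous[TopologicalSpace.compactlyGenerated.{u} X, t] f

/-- A `G`-space: a compactly generated weakly Hausdorff space with a continuous action of `G`. -/
class IsGSpace (G : Type u) [Group G] [TopologicalSpace G] (X : Type u) [TopologicalSpace X]
    [MulAction G X] : Prop extends ContinuousSMul G X where
  compactlyGenerated : CompactlyGeneratedSpace X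
  weaklyHausdorff : IsWeaklyHausdorff X

/-- A based `G`-space: a `G`-space with a `G`-fixed base point. -/
structure BasedGSpace (G : Type u) [Group G] [TopologicalSpace G] where
  carrier : Type u
  [topologicalSpace : TopologicalSpace carrier]
  [mulAction : MulAction G carrier]
  [isGSpace : IsGSpace G carrier]
  pt : carrier
  smul_pt : ∀ g : G, g • pt = pt

attribute [instance] BasedGSpace.topologicalSpace BasedGSpace.mulAction BasedGSpace.isGSpace

/-! ### Operads in `G`-spaces and their algebras -/

/-- A symmetric operad in `G`-spaces, in coordinate-free form: the operations are indexed by finite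
sets `I` of inputs instead of by numbers only. The usual `n`-th term `O(n)` is `obj (Fin n)`, on
which `Σ_n` acts through `relabel`, and `comp` is the usual operadic composition
`O(I) × ∏_{i ∈ I} O(J i) → O(∐_{i ∈ I} J i)`. -/
structure GOperad (G : Type u) [Group G] [TopologicalSpace G] where
  obj : (I : Type) → [Finite I] → Type u
  [topologicalSpace : ∀ (I : Type) [Finite I], TopologicalSpace (obj I)]
  [mulAction : ∀ (I : Type) [Finite I], MulAction G (obj I)]
  [isGSpace : ∀ (I : Type) [Finite I], IsGSpace G (obj I)]
  /-- functoriality in bijections of the set of inputs -/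
  relabel : ∀ {I J : Type} [Finite I] [Finite J], I ≃ J → obj I → obj J
  continuous_relabel : ∀ {I J : Type} [Finite I] [Finite J] (e : I ≃ J), Continuous (relabel e)
  relabel_smul : ∀ {I J : Type} [Finite I] [Finite J] (e : I ≃ J) (g : G) (a : obj I),
    relabel e (g • a) = g • relabel e a
  relabel_refl : ∀ {I : Type} [Finite I] (a : obj I), relabel (Equiv.refl I) a = a
  relabel_trans : ∀ {I J L : Type} [Finite I] [Finite J] [Finite L] (e : I ≃ J) (f : J ≃ L)
    (a : obj I), relabel (e.trans f) a = relabel f (relabel e a)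
  /-- the identity operation -/
  one : obj Unit
  smul_one : ∀ g : G, g • one = one
  /-- operadic composition -/
  comp : ∀ {I : Type} {J : I → Type} [Finite I] [∀ i, Finite (J i)],
    obj I → (∀ i, obj (J i)) → obj (Σ i, J i)
  kcontinuous_comp : ∀ {I : Type} {J : I → Type} [Finite I] [∀ i, Finite (J i)],
    KContinuous (fun p : obj I × (∀ i, obj (J i)) => comp p.1 p.2)
  comp_smul : ∀ {I : Type} {J : I → Type} [Finite I] [∀ i, Finite (J i)]
    (g : G) (a : obj I) (b : ∀ i, obj (J i)), comp (g • a) (fun i => g • b i) = g • comp a b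
  comp_relabel_right : ∀ {I : Type} {J J' : I → Type} [Finite I] [∀ i, Finite (J i)]
    [∀ i, Finite (J' i)] (e : ∀ i, J i ≃ J' i) (a : obj I) (b : ∀ i, obj (J i)),
    comp a (fun i => relabel (e i) (b i)) = relabel (Equiv.sigmaCongrRight e) (comp a b)
  comp_relabel_left : ∀ {I I' : Type} {J : I' → Type} [Finite I] [Finite I'] [∀ i, Finite (J i)]
    (e : I ≃ I') (a : obj I) (b : ∀ i, obj (J i)),
    comp (relabel e a) b
      = relabel (Equiv.sigmaCongrLeft (β := J) e) (comp a (fun i => b (e i)))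
  one_comp : ∀ {J : Type} [Finite J] (b : obj J),
    relabel (Equiv.uniqueSigma (fun _ : Unit => J)) (comp one (fun _ => b)) = b
  comp_one : ∀ {I : Type} [Finite I] (a : obj I),
    relabel (Equiv.sigmaUnique I (fun _ => Unit)) (comp a (fun _ => one)) = a
  comp_assoc : ∀ {I : Type} {J : I → Type} {L : ∀ i, J i → Type} [Finite I] [∀ i, Finite (J i)]
    [∀ i j, Finite (L i j)] (a : obj I) (b : ∀ i, obj (J i))
    (c : ∀ p : Σ i, J i, obj (L p.1 p.2)),
    relabel (Equiv.sigmaAssoc L) (comp (comp a b) c)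
      = comp a (fun i => comp (b i) (fun j => c ⟨i, j⟩))

attribute [instance] GOperad.topologicalSpace GOperad.mulAction GOperad.isGSpace

namespace GOperad

variable {G : Type u} [Group G] [TopologicalSpace G]

/-- The `Γ`-fixed points of the `G × Σ_n`-space `O(n)`. -/
def fixed (O : GOperad G) (n : ℕ) (Γ : Subgroup (G × Equiv.Perm (Fin n))) :
    Set (O.obj (Fin n)) :=
  {a | ∀ γ ∈ Γ, γ.1 • O.relabel γ.2 a = a}

/-- `O` is an `E_∞^G`-operad: for every `n`, its `n`-th term is a universal space for the family
of those closed subgroups `Γ` of `G × Σ_n` with `Γ ∩ Σ_n = 1`. That is, for closed `Γ` the space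
of `Γ`-fixed points is contractible if `Γ` is in the family, and empty otherwise. -/
def IsEInftyG (O : GOperad G) : Prop :=
  ∀ (n : ℕ) (Γ : Subgroup (G × Equiv.Perm (Fin n))),
    -- `Γ` is closed in `G × Σ_n`, where `Σ_n` is discrete
    (∀ σ, IsClosed {g : G | (g, σ) ∈ Γ}) →
      ((∀ σ, ((1 : G), σ) ∈ Γ → σ = 1) → ContractibleSpace (O.fixed n Γ)) ∧
      ((∃ σ, ((1 : G), σ) ∈ Γ ∧ σ ≠ 1) → O.fixed n Γ = ∅)

/-- The structure on a based `G`-space `Y` of an algebra over the operad `O`: an associative,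
unital, equivariant system of based `G`-maps `O(I)₊ ∧ Y^{∧ I} → Y`, given as the maps
`O(I) × Y^I → Y` that send each point with some coordinate at the base point to the base point. -/
structure Algebra (O : GOperad G) (Y : BasedGSpace G) where
  act : ∀ {I : Type} [Finite I], O.obj I → (I → Y.carrier) → Y.carrier
  kcontinuous_act : ∀ {I : Type} [Finite I],
    KContinuous (fun p : O.obj I × (I → Y.carrier) => act p.1 p.2)
  act_pt : ∀ {I : Type} [Finite I] (a : O.obj I) (y : I → Y.carrier) (i : I),
    y i = Y.pt → act a y = Y.pt
  act_smul : ∀ {I : Type} [Finite I] (g : G) (a : O.obj I) (y : I → Y.carrier),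
    act (g • a) (fun i => g • y i) = g • act a y
  act_relabel : ∀ {I J : Type} [Finite I] [Finite J] (e : I ≃ J) (a : O.obj I)
    (y : J → Y.carrier), act (O.relabel e a) y = act a (fun i => y (e i))
  act_one : ∀ y : Unit → Y.carrier, act O.one y = y ()
  act_comp : ∀ {I : Type} {J : I → Type} [Finite I] [∀ i, Finite (J i)]
    (a : O.obj I) (b : ∀ i, O.obj (J i)) (y : (Σ i, J i) → Y.carrier),
    act (O.comp a b) y = act a (fun i => act (b i) (fun j => y ⟨i, j⟩))

end GOperad

/-- A based `G`-space is an `E_∞^G`-algebra if some `E_∞^G`-operad acts on it. -/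
def IsEInftyGAlgebra {G : Type u} [Group G] [TopologicalSpace G] (Y : BasedGSpace G) : Prop :=
  ∃ O : GOperad G, O.IsEInftyG ∧ Nonempty (O.Algebra Y)

/-! ### The space `S^{∞V(K)}` -/

noncomputable section Sphere

variable (G : Type u) [Group G] [TopologicalSpace G]

/-- The complete `G`-universe `⨁_χ ℂ_χ^{⊕ ℕ}` of a torus `G`: the sum of countably many copies of
each character `χ : G → S¹`, realized as the finitely supported functions of the pairs `(χ, n)`.
It carries the topology of coordinatewise convergence; on a finite-dimensional subspace this is the
usual topology. -/
def completeUniverse : Submodule ℝ ((G →ₜ* Circle) × ℕ → ℂ) where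
  carrier := {f | f.support.Finite}
  zero_mem' := by simp
  add_mem' := fun ha hb => (ha.union hb).subset (Function.support_add _ _)
  smul_mem' := fun c f hf => Set.Finite.subset hf fun i hi => by
    simp only [Function.mem_support, Pi.smul_apply] at hi ⊢
    exact fun h => hi (by simp [h])

/-- The action of `G` on the complete universe: `g` multiplies the `(χ, n)` coordinate by `χ g`. -/
def universeRep : Representation ℝ G (completeUniverse G) where
  toFun g :=
    { toFun := fun f => ⟨fun i => (i.1 g : ℂ) * f.1 i, Set.Finite.subset f.2 fun i hi => by
        simp only [Function.mem_support] at hi ⊢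
        exact fun h => hi (by simp [h])⟩
      map_add' := fun a b => by ext i; simp [mul_add]
      map_smul' := fun c a => by ext i; simp [mul_left_comm] }
  map_one' := by ext f i; simp
  map_mul' g h := by ext f i; simp [mul_assoc]

variable {G}

/-- `V` is a finite-dimensional subrepresentation of the complete universe with `V^K = 0`. -/
structure IsFixedFree (K : Subgroup G) (V : Submodule ℝ (completeUniverse G)) : Prop where
  finiteDimensional : FiniteDimensional ℝ V
  invariant : ∀ g : G, ∀ v ∈ V, universeRep G g v ∈ V
  fixed_eq_zero : ∀ v ∈ V, (∀ k ∈ K, universeRep G k v = v) → v = 0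

/-- The points of `S^{∞V(K)} = ⋃_{V^K = 0} S^V`, where `S^V` is the one-point compactification
of `V`, and all the spheres have the same point at infinity. -/
def SInfty (K : Subgroup G) : Type u :=
  {x : OnePoint (completeUniverse G) //
    ∃ V, IsFixedFree K V ∧ x ∈ Set.range (OnePoint.map (V.subtype : V → completeUniverse G))}

namespace SInfty

variable {K : Subgroup G}

/-- The inclusion of `S^V`. -/
def incl (V : {V : Submodule ℝ (completeUniverse G) // IsFixedFree K V}) (x : OnePoint V.1) :
    SInfty K :=
  ⟨OnePoint.map V.1.subtype x, V.1, V.2, x, rfl⟩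

/-- The colimit topology: a set is open if and only if its trace on each `S^V` is open. -/
instance : TopologicalSpace (SInfty K) :=
  ⨆ V : {V : Submodule ℝ (completeUniverse G) // IsFixedFree K V},
    TopologicalSpace.coinduced (incl V) inferInstance

/-- The action of `G` is the linear one on each `S^V`, and fixes the point at infinity. -/
instance : MulAction G (SInfty K) where
  smul g x := ⟨OnePoint.map (universeRep G g) x.1, by
    obtain ⟨_, V, hV, x, rfl⟩ := x
    refine ⟨V, hV, OnePoint.map (fun v : V => ⟨universeRep G g v, hV.invariant g v v.2⟩) x, ?_⟩
    cases x <;> rfl⟩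
  one_smul x := by
    obtain ⟨x, hx⟩ := x
    refine Subtype.ext ?_
    change OnePoint.map (universeRep G 1) x = x
    cases x <;> simp
  mul_smul g h x := by
    obtain ⟨x, hx⟩ := x
    refine Subtype.ext ?_
    change OnePoint.map (universeRep G (g * h)) x
      = OnePoint.map (universeRep G g) (OnePoint.map (universeRep G h) x)
    cases x <;> simp


theorem isCompact_box {V : Submodule ℝ (completeUniverse G)} (hV : FiniteDimensional ℝ V) (C : ℝ) :
    IsCompact {v : V | ∀ i, ‖v.1.1 i‖ ≤ C} := by
  have hemb : IsClosedEmbedding (fun v : V => v.1.1) := by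
    refine ⟨(IsEmbedding.subtypeVal).comp IsEmbedding.subtypeVal, ?_⟩
    have h := Submodule.closed_of_finiteDimensional (V.map (completeUniverse G).subtype)
    convert h using 1
    ext f
    simp [Set.mem_range]
  have h := hemb.isCompact_preimage
    (isCompact_univ_pi (fun _ : (G →ₜ* Circle) × ℕ => isCompact_closedBall (0 : ℂ) C))
  convert h using 1
  ext v
  simp [Set.mem_pi]

theorem isOpen_box {V : Submodule ℝ (completeUniverse G)} (hV : FiniteDimensional ℝ V) {C : ℝ}
    (hC : 0 < C) : IsOpen {v : V | ∀ i, ‖v.1.1 i‖ < C} := by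
  obtain ⟨S, hS⟩ : V.FG := (Submodule.fg_top V).1 hV.1
  have hfin : (⋃ s ∈ S, Function.support s.1).Finite :=
    Set.Finite.biUnion S.finite_toSet fun s _ => s.2
  have hsupp : ∀ v ∈ V, ∀ i ∉ (⋃ s ∈ S, Function.support s.1), v.1 i = 0 := by
    intro v hv i hi
    rw [← hS] at hv
    induction hv using Submodule.span_induction with
    | mem x hx =>
      by_contra h
      exact hi (Set.mem_biUnion hx h)
    | zero => rfl
    | add x y _ _ hx hy => simp [hx, hy]
    | smul c x _ hx => simp [hx]
  have heq : {v : V | ∀ i, ‖v.1.1 i‖ < C}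
      = ⋂ i ∈ (⋃ s ∈ S, Function.support s.1), {v : V | ‖v.1.1 i‖ < C} := by
    ext v
    simp only [Set.mem_iInter, Set.mem_ofPred_eq]
    refine ⟨fun h i _ => h i, fun h i => ?_⟩
    by_cases hi : i ∈ (⋃ s ∈ S, Function.support s.1)
    · exact h i hi
    · rw [hsupp v.1 v.2 i hi]
      simpa using hC
  rw [heq]
  refine hfin.isOpen_biInter fun i _ => ?_
  have hc : Continuous fun v : V => v.1.1 i :=
    (continuous_apply i).comp (continuous_subtype_val.comp continuous_subtype_val)
  exact isOpen_lt hc.norm continuous_const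

theorem exists_bound (f : completeUniverse G) : ∃ C : ℝ, 0 < C ∧ ∀ i, ‖f.1 i‖ < C := by
  obtain ⟨B, hB⟩ := (f.2.image fun i => ‖f.1 i‖).bddAbove
  refine ⟨max B 0 + 1, by positivity, fun i => ?_⟩
  by_cases hi : f.1 i = 0
  · rw [hi, norm_zero]
    positivity
  · have := hB (Set.mem_image_of_mem _ (show i ∈ Function.support f.1 from hi))
    have h2 := le_max_left B 0
    linarith

theorem locallyCompact {V : Submodule ℝ (completeUniverse G)} (hV : FiniteDimensional ℝ V) :
    WeaklyLocallyCompactSpace V where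
  exists_compact_mem_nhds v := by
    obtain ⟨C, hC, hv⟩ := exists_bound v.1
    refine ⟨_, isCompact_box hV C, Filter.mem_of_superset ((isOpen_box hV hC).mem_nhds hv) ?_⟩
    exact fun w hw i => (hw i).le

theorem isOpen_iff {s : Set (SInfty K)} : IsOpen s ↔ ∀ V, IsOpen (incl V ⁻¹' s) := by
  simp only [isOpen_iSup_iff, isOpen_coinduced]

theorem continuous_incl (V : {V : Submodule ℝ (completeUniverse G) // IsFixedFree K V}) :
    Continuous (incl V) :=
  continuous_def.2 fun _ hs => isOpen_iff.1 hs V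

theorem continuous_dom {Z : Type*} [TopologicalSpace Z] {f : SInfty K → Z}
    (h : ∀ V, Continuous (f ∘ incl V)) : Continuous f :=
  continuous_def.2 fun s hs => isOpen_iff.2 fun V => (h V).isOpen_preimage s hs

theorem exists_incl (x : SInfty K) : ∃ V y, incl V y = x := by
  obtain ⟨_, V, hV, y, rfl⟩ := x
  exact ⟨⟨V, hV⟩, y, rfl⟩

instance : T2Space (SInfty K) := by
  have hfin : ∀ W : Set (completeUniverse G), IsOpen W →
      IsOpen {x : SInfty K | ∃ f ∈ W, x.1 = ↑f} := by
    intro W hW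
    refine isOpen_iff.2 fun V => ?_
    rw [OnePoint.isOpen_def]
    refine ⟨fun h => ?_, ?_⟩
    · obtain ⟨f, _, hf⟩ := h
      exact absurd hf (OnePoint.infty_ne_coe f)
    · convert hW.preimage (continuous_subtype_val : Continuous (fun v : V.1 => v.1)) using 1
      ext v
      constructor
      · rintro ⟨f, hf, h⟩
        have : v.1 = f := OnePoint.coe_injective h
        rwa [Set.mem_preimage, this]
      · intro h
        exact ⟨v.1, h, rfl⟩
  have hinf : ∀ x y : SInfty K, ∀ f : completeUniverse G, x.1 = ↑f → y.1 = ∞ →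
      ∃ u v : Set (SInfty K), IsOpen u ∧ IsOpen v ∧ x ∈ u ∧ y ∈ v ∧ Disjoint u v := by
    intro x y f hx hy
    obtain ⟨C, hC, hf⟩ := exists_bound f
    refine ⟨{x | ∃ f : completeUniverse G, (∀ i, ‖f.1 i‖ < C) ∧ x.1 = ↑f},
      {x | ∃ f : completeUniverse G, (∀ i, ‖f.1 i‖ ≤ C) ∧ x.1 = ↑f}ᶜ, ?_, ?_, ⟨f, hf, hx⟩, ?_, ?_⟩
    · refine isOpen_iff.2 fun V => ?_
      rw [OnePoint.isOpen_def]
      refine ⟨fun h => ?_, ?_⟩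
      · obtain ⟨f, _, hf⟩ := h
        exact absurd hf (OnePoint.infty_ne_coe f)
      · convert isOpen_box V.2.finiteDimensional hC using 1
        ext v
        constructor
        · rintro ⟨f, hf, h⟩
          have : v.1 = f := OnePoint.coe_injective h
          rwa [Set.mem_ofPred_eq, this]
        · intro h
          exact ⟨v.1, h, rfl⟩
    · refine isOpen_iff.2 fun V => ?_
      have hc := isCompact_box V.2.finiteDimensional C
      have := (OnePoint.isOpen_compl_image_coe (s := {v : V.1 | ∀ i, ‖v.1.1 i‖ ≤ C})).2
        ⟨hc.isClosed, hc⟩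
      convert this using 1
      ext z
      simp only [Set.mem_preimage, Set.mem_compl_iff, not_iff_not, Set.mem_ofPred_eq]
      constructor
      · rintro ⟨f, hf, h⟩
        cases z with
        | infty => exact absurd h (OnePoint.infty_ne_coe f)
        | coe v =>
          have : v.1 = f := OnePoint.coe_injective h
          exact ⟨v, by rwa [Set.mem_ofPred_eq, this], rfl⟩
      · rintro ⟨v, hv, rfl⟩
        exact ⟨v.1, hv, rfl⟩
    · rintro ⟨f, _, hf⟩
      rw [hy] at hf
      exact OnePoint.infty_ne_coe f hf
    · rw [Set.disjoint_compl_right_iff_subset]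
      rintro z ⟨f, hf, h⟩
      exact ⟨f, fun i => (hf i).le, h⟩
  refine ⟨fun x y hxy => ?_⟩
  obtain ⟨x, hx⟩ := x
  obtain ⟨y, hy⟩ := y
  cases x with
  | infty =>
    cases y with
    | infty => exact absurd rfl hxy
    | coe g =>
      obtain ⟨u, v, hu, hv, h1, h2, h⟩ := hinf ⟨_, hy⟩ ⟨_, hx⟩ g rfl rfl
      exact ⟨v, u, hv, hu, h2, h1, h.symm⟩
  | coe f =>
    cases y with
    | infty => exact hinf _ _ f rfl rfl
    | coe g =>
      have hne : f ≠ g := fun h => hxy (by subst h; rfl)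
      obtain ⟨u, v, hu, hv, h1, h2, h⟩ := t2_separation hne
      refine ⟨_, _, hfin u hu, hfin v hv, ⟨f, h1, rfl⟩, ⟨g, h2, rfl⟩, ?_⟩
      rw [Set.disjoint_left] at h ⊢
      rintro z ⟨a, ha, hz⟩ ⟨b, hb, hz'⟩
      have hab : a = b := OnePoint.coe_injective (hz.symm.trans hz')
      exact h ha (hab ▸ hb)

instance : CompactlyGeneratedSpace (SInfty K) := by
  refine compactlyGeneratedSpace_of_isOpen fun s h => isOpen_iff.2 fun V => ?_
  have := locallyCompact V.2.finiteDimensional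
  exact h (OnePoint V.1) (incl V) (continuous_incl V)

theorem continuous_smul_coe {V : Submodule ℝ (completeUniverse G)} (hV : IsFixedFree K V) :
    Continuous fun p : G × V =>
      (⟨universeRep G p.1 p.2, hV.invariant p.1 p.2 p.2.2⟩ : V) := by
  refine Continuous.subtype_mk (Continuous.subtype_mk (continuous_pi fun i => ?_) _) _
  have h1 : Continuous fun p : G × V => (i.1 p.1 : ℂ) :=
    continuous_subtype_val.comp (i.1.continuous_toFun.comp continuous_fst)
  have h2 : Continuous fun p : G × V => p.2.1.1 i :=
    (continuous_apply i).comp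
      (continuous_subtype_val.comp (continuous_subtype_val.comp continuous_snd))
  exact h1.mul h2

theorem continuous_smul_sphere [ContinuousInv G] [CompactSpace G]
    {V : Submodule ℝ (completeUniverse G)}
    (hV : IsFixedFree K V) :
    Continuous fun p : OnePoint V × G =>
      OnePoint.map (fun v : V => (⟨universeRep G p.2 v, hV.invariant p.2 v v.2⟩ : V)) p.1 := by
  have hc := continuous_smul_coe hV
  refine continuous_iff_continuousAt.2 ?_
  rintro ⟨x, g⟩
  cases x with
  | coe v =>
    have he : IsOpenEmbedding (Prod.map ((↑) : V → OnePoint V) (id : G → G)) :=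
      OnePoint.isOpenEmbedding_coe.prodMap .id
    refine (he.continuousAt_iff (x := (v, g))).1 ?_
    exact (OnePoint.continuous_coe.comp (hc.comp continuous_swap)).continuousAt
  | infty =>
    intro s hs
    change s ∈ 𝓝 (∞ : OnePoint V) at hs
    obtain ⟨C, ⟨hC1, hC2⟩, hCs⟩ := (OnePoint.hasBasis_nhds_infty (X := V)).mem_iff.1 hs
    have hC' : IsCompact ((fun p : G × V =>
        (⟨universeRep G p.1⁻¹ p.2, hV.invariant p.1⁻¹ p.2 p.2.2⟩ : V)) '' (Set.univ ×ˢ C)) :=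
      (isCompact_univ.prod hC2).image
        (hc.comp ((continuous_inv.comp continuous_fst).prodMk continuous_snd))
    have hopen := (OnePoint.isOpen_compl_image_coe).2 ⟨hC'.isClosed, hC'⟩
    refine Filter.mem_map.2 (Filter.mem_of_superset
      ((hopen.preimage (continuous_fst : Continuous (Prod.fst : OnePoint V × G → _))).mem_nhds
        (x := (∞, g)) (by rintro ⟨w, _, hw⟩; exact OnePoint.coe_ne_infty w hw)) ?_)
    rintro ⟨z, h⟩ hz
    refine hCs ?_
    cases z with
    | infty => exact Or.inr rfl
    | coe v =>
      refine Or.inl ⟨_, ?_, rfl⟩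
      intro hmem
      refine hz ⟨v, ⟨(h, _), ⟨trivial, hmem⟩, ?_⟩, rfl⟩
      ext1
      change universeRep G h⁻¹ (universeRep G h v) = v
      rw [← Module.End.mul_apply, ← map_mul]
      simp

theorem isGSpace [IsTorus G] : IsGSpace G (SInfty K) := by
  obtain ⟨r, ⟨e⟩⟩ := IsTorus.exists_equiv (G := G)
  have : CompactSpace G := e.symm.toHomeomorph.compactSpace
  have : T2Space G := e.toHomeomorph.isEmbedding.t2Space
  have : ContinuousInv G := ⟨by
    have h : (fun g : G => g⁻¹) = fun g => e.symm (e g)⁻¹ := by ext g; simp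
    rw [h]
    exact e.symm.continuous.comp (e.continuous.inv)⟩
  refine { continuous_smul := ?_, compactlyGenerated := inferInstance, weaklyHausdorff := ?_ }
  · let F : SInfty K → C(G, SInfty K) := fun x => ⟨fun g => g • x, by
      obtain ⟨V, y, rfl⟩ := exists_incl x
      have h := (continuous_incl V).comp
        ((continuous_smul_sphere V.2).comp (Continuous.prodMk_right y))
      convert h using 1
      ext1 g
      refine Subtype.ext ?_
      change OnePoint.map _ (OnePoint.map _ _) = OnePoint.map _ (OnePoint.map _ _)
      cases y <;> rfl⟩
    have hF : Continuous F := by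
      refine continuous_dom fun V => ContinuousMap.continuous_of_continuous_uncurry _ ?_
      have h := (continuous_incl V).comp (continuous_smul_sphere V.2)
      convert h using 1
      ext1 ⟨y, g⟩
      refine Subtype.ext ?_
      change OnePoint.map _ (OnePoint.map _ _) = OnePoint.map _ (OnePoint.map _ _)
      cases y <;> rfl
    exact (ContinuousMap.continuous_uncurry_of_continuous ⟨F, hF⟩).comp continuous_swap
  · exact fun T _ _ _ f hf => (isCompact_range hf).isClosed

theorem isFixedFree_bot (K : Subgroup G) : IsFixedFree K ⊥ where
  finiteDimensional := inferInstance
  invariant g v hv := by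
    rw [Submodule.mem_bot] at hv ⊢
    rw [hv, map_zero]
  fixed_eq_zero v hv _ := by simpa using hv

end SInfty

/-- The based `G`-space `S^{∞V(K)} = ⋃_{V^K = 0} S^V`, based at the point at infinity. -/
def sphereInfty [IsTorus G] (K : Subgroup G) : BasedGSpace G where
  carrier := SInfty K
  isGSpace := SInfty.isGSpace
  pt := SInfty.incl ⟨⊥, SInfty.isFixedFree_bot K⟩ ∞
  smul_pt _ := rfl

end Sphere

/-!
# `S^{∞V(K)}` is an `E_∞^G`-algebra

The operad is a variant of the linear isometries operad, made of injective linear maps, so that no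
inner product is needed. Let `A` be the set of pairs `(χ, n)` that index the coordinates of the
complete universe `U = ℂ^(A)`, let `A'` be the set of those with `χ` nontrivial on `K`
(`freeIndex`), and let `U' ⊆ U` be the vectors supported in `A'`. The operad has as `I`-th term the
injective complex linear maps `f : U^I → U` that map `U'^I` into `U'` (`LinearOperation`), with
`G` acting by conjugation and with composition of maps as operadic composition (`linearOperad`).

A subrepresentation `V` with `V^K = 0` lies in `U'` (`IsFixedFree.mem_freeIndex`), and every finite
set of coordinates in `A'` spans such a `V`. So `S^{∞V(K)}` is the one-point compactification of
`U'` in the colimit sense, and `f` acts by `(y_i) ↦ f(y)`, with value `∞` as soon as some `y_i` is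
`∞` (`SInfty.act`). This is continuous because a compact family of injective linear maps between
finite-dimensional spaces is uniformly proper (`SInfty.continuous_act`).

The topology on the operad is the finest one for which families over compact Hausdorff spaces are
continuous as soon as, on each vector, they have continuous coordinates in a common finite set. By
a compactness argument (`exists_finset_support_subset`) every continuous map from a compact
Hausdorff space is such a family (`LinearOperation.isFamily_of_continuous`), so that continuity in
compactly generated spaces can be tested on families.

For the universal property, let `Γ` be a closed subgroup of `G × Σ_n`. A permutation of the inputs
cannot fix an injective map, so there are no fixed operations if `Γ` meets `Σ_n` nontrivially.
Otherwise `Γ` is the graph of `φ : H → Σ_n` with `H` closed in `G`.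

* There is a fixed operation `f₀` (`exists_isFixed`). Under the finite abelian group `φ(H)`, a
  family of vectors decomposes by Fourier inversion into components on which `H` acts through the
  universe, twisted by a character `ψ` of `H` of finite image. So it is enough to twist the
  characters of `G` by a given `ψ`, in an injective way and without making characters trivial on
  `K` out of nontrivial ones (`exists_character_twist`). The character `ψ` extends to some `β` on
  `G`. If `K ⊆ H`, then `ψ` is trivial on `K`, since `K` is connected, and `χ * β` will do. If not,
  there is a character trivial on `H` and not on `K`, by which `χ * β` can be corrected. The
  extension and the separation of characters follow from the Stone–Weierstrass theorem and the
  vanishing of the mean of a nontrivial character over a compact group.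
* The fixed operations contract to a point (`LinearOperation.contractibleSpace_isFixed`). Shifting
  the second indices of coordinates to odd or positive even numbers gives equivariant injections
  of `U` into itself with independent images. The operation `f` moves linearly to its odd shift,
  which moves linearly to the even shift of `f₀`, through injective maps.
-/

/-! ### Characters of a torus -/

section Characters

open MeasureTheory

/-- A form of the Stone–Weierstrass theorem: no nonzero functional vanishes on a set of functions
that separates points and is closed under products and conjugation. -/
theorem ContinuousMap.clm_eq_zero_of_separating {M : Type*} [TopologicalSpace M] [CompactSpace M]
    {S : Set C(M, ℂ)} (h_one : 1 ∈ S) (h_mul : ∀ f ∈ S, ∀ g ∈ S, f * g ∈ S)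
    (h_star : ∀ f ∈ S, star f ∈ S) (h_sep : ∀ x y, x ≠ y → ∃ f ∈ S, f x ≠ f y)
    (L : C(M, ℂ) →L[ℂ] ℂ) (hL : ∀ f ∈ S, L f = 0) : L = 0 := by
  let A : StarSubalgebra ℂ C(M, ℂ) :=
    { toSubalgebra := Algebra.adjoin ℂ S
      star_mem' := by
        change Algebra.adjoin ℂ S ≤ star (Algebra.adjoin ℂ S)
        exact Algebra.adjoin_le fun f hf => Algebra.subset_adjoin (h_star f hf) }
  have hA : A.SeparatesPoints := by
    intro x y hxy
    obtain ⟨f, hf, hfxy⟩ := h_sep x y hxy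
    exact ⟨_, ⟨f, Algebra.subset_adjoin hf, rfl⟩, hfxy⟩
  have htop := ContinuousMap.starSubalgebra_topologicalClosure_eq_top_of_separatesPoints A hA
  have hspan : Subalgebra.toSubmodule (Algebra.adjoin ℂ S) = Submodule.span ℂ S := by
    refine Algebra.adjoin_eq_span_of_subset ℂ (.trans (fun f hf => ?_) Submodule.subset_span)
    exact Submonoid.closure_induction (fun _ h => h) h_one (fun f g _ _ hf hg => h_mul f hf g hg) hf
  have hdense : Dense (A : Set C(M, ℂ)) := by
    intro f
    have hf : f ∈ A.topologicalClosure := htop ▸ StarSubalgebra.mem_top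
    exact hf
  have hker : ∀ f ∈ A, L f = 0 := by
    intro f hf
    have hf' : f ∈ Submodule.span ℂ S := hspan ▸ hf
    exact (Submodule.span_le (p := LinearMap.ker L.toLinearMap)).2 hL hf'
  ext1 f
  exact congrFun (Continuous.ext_on hdense L.continuous continuous_const hker) f

/-- Integration against a finite measure on a compact space. -/
noncomputable def ContinuousMap.integralFunctional {M : Type*} [TopologicalSpace M]
    [CompactSpace M] [MeasurableSpace M] [BorelSpace M] (μ : Measure M) [IsFiniteMeasure μ] :
    C(M, ℂ) →L[ℂ] ℂ :=
  LinearMap.mkContinuous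
    { toFun := fun f => ∫ x, f x ∂μ
      map_add' := fun f g => integral_add
        (f.continuous.integrable_of_hasCompactSupport (.of_compactSpace _))
        (g.continuous.integrable_of_hasCompactSupport (.of_compactSpace _))
      map_smul' := fun c f => integral_const_mul c _ }
    (μ.real Set.univ) fun f => by
      rw [mul_comm]
      exact norm_integral_le_of_norm_le_const (Filter.Eventually.of_forall f.norm_coe_le_norm)

theorem integral_character_eq_zero {H : Type*} [Group H] [TopologicalSpace H]
    [IsTopologicalGroup H] [MeasurableSpace H] [BorelSpace H] (μ : Measure H)
    [μ.IsMulLeftInvariant] (χ : H →ₜ* Circle) (hχ : ∃ h, χ h ≠ 1) :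
    ∫ h, (χ h : ℂ) ∂μ = 0 := by
  obtain ⟨k, hk⟩ := hχ
  have h1 : ∫ h, (χ (k * h) : ℂ) ∂μ = ∫ h, (χ h : ℂ) ∂μ :=
    integral_mul_left_eq_self (fun h => (χ h : ℂ)) k
  simp only [map_mul, Circle.coe_mul, integral_const_mul] at h1
  have h2 : (χ k : ℂ) - 1 ≠ 0 := sub_ne_zero.2 fun h => hk (Circle.ext h)
  have h3 : ((χ k : ℂ) - 1) * ∫ h, (χ h : ℂ) ∂μ = 0 := by rw [sub_mul, h1, one_mul, sub_self]
  exact (mul_eq_zero.1 h3).resolve_left h2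

variable {G : Type*} [Group G] [TopologicalSpace G]

/-- A character as a complex-valued continuous function. -/
noncomputable def ContinuousMonoidHom.toComplex (χ : G →ₜ* Circle) : C(G, ℂ) :=
  ⟨fun g => χ g, continuous_subtype_val.comp χ.continuous_toFun⟩

/-- A continuous functional on `C(H, ℂ)` which vanishes on the restrictions of the characters of
`G` vanishes. -/
theorem clm_eq_zero_of_characters (hsep : ∀ x : G, x ≠ 1 → ∃ χ : G →ₜ* Circle, χ x ≠ 1)
    {M : Type*} [TopologicalSpace M] [CompactSpace M] (j : C(M, G)) (hj : Function.Injective j)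
    (L : C(M, ℂ) →L[ℂ] ℂ) (hL : ∀ χ : G →ₜ* Circle, L (χ.toComplex.comp j) = 0) : L = 0 := by
  refine ContinuousMap.clm_eq_zero_of_separating
    (S := Set.range fun χ : G →ₜ* Circle => χ.toComplex.comp j)
    ⟨1, ?_⟩ ?_ ?_ ?_ L (by rintro _ ⟨χ, rfl⟩; exact hL χ)
  · ext x
    simp [ContinuousMonoidHom.toComplex]
  · rintro _ ⟨χ, rfl⟩ _ ⟨θ, rfl⟩
    refine ⟨χ * θ, ?_⟩
    ext x
    simp [ContinuousMonoidHom.toComplex]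
  · rintro _ ⟨χ, rfl⟩
    refine ⟨χ⁻¹, ?_⟩
    ext x
    exact Circle.coe_inv_eq_conj (χ (j x))
  · intro x y hxy
    obtain ⟨χ, hχ⟩ := hsep ((j x)⁻¹ * j y) fun h => hxy (hj (inv_mul_eq_one.1 h))
    refine ⟨_, ⟨χ, rfl⟩, fun h => hχ ?_⟩
    have h' : χ (j x) = χ (j y) := Circle.ext h
    rw [map_mul, map_inv, h', inv_mul_cancel]

variable [IsTopologicalGroup G] [CompactSpace G] [T2Space G]

/-- Characters extend from a closed subgroup: otherwise all the restrictions of characters of `G`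
would be orthogonal to `ψ`, against their density. -/
theorem exists_character_extension (hsep : ∀ x : G, x ≠ 1 → ∃ χ : G →ₜ* Circle, χ x ≠ 1)
    (H : Subgroup G) (hH : IsClosed (H : Set G)) (ψ : H →ₜ* Circle) :
    ∃ χ : G →ₜ* Circle, ∀ h : H, χ h = ψ h := by
  by_contra! hcon
  have : CompactSpace H := isCompact_iff_compactSpace.1 hH.isCompact
  let _ : MeasurableSpace H := borel H
  have : BorelSpace H := ⟨rfl⟩
  let μ : Measure H := Measure.haar
  let j : C(H, G) := ⟨Subtype.val, continuous_subtype_val⟩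
  let L : C(H, ℂ) →L[ℂ] ℂ := (ContinuousMap.integralFunctional μ).comp
    (ContinuousLinearMap.mul ℂ C(H, ℂ) (star ψ.toComplex))
  have hL : L = 0 := by
    refine clm_eq_zero_of_characters hsep j Subtype.val_injective L fun χ => ?_
    let θ : H →ₜ* Circle := ψ⁻¹ * χ.comp ⟨H.subtype, continuous_subtype_val⟩
    have hθ : ∫ h, (θ h : ℂ) ∂μ = 0 := by
      refine integral_character_eq_zero μ θ ?_
      obtain ⟨h, hh⟩ := hcon χ
      exact ⟨h, fun h' => hh (inv_mul_eq_one.1 h').symm⟩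
    rw [← hθ]
    refine integral_congr_ae (Filter.Eventually.of_forall fun h => ?_)
    change star (ψ h : ℂ) * (χ h : ℂ) = (((ψ h)⁻¹ * χ h : Circle) : ℂ)
    rw [Circle.coe_mul, Circle.coe_inv_eq_conj]
    rfl
  have h1 : L ψ.toComplex = μ.real Set.univ := by
    have : L ψ.toComplex = ∫ _ : H, (1 : ℂ) ∂μ := by
      refine integral_congr_ae (Filter.Eventually.of_forall fun h => ?_)
      change star (ψ h : ℂ) * (ψ h : ℂ) = 1
      rw [mul_comm]
      exact (Complex.mul_conj _).trans (by simp [Circle.normSq_coe])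
    rw [this]
    simp
  rw [hL] at h1
  have h2 : μ.real Set.univ ≠ 0 := by
    rw [Measure.real, Ne, ENNReal.toReal_eq_zero_iff, not_or]
    exact ⟨(isOpen_univ.measure_pos μ Set.univ_nonempty).ne', measure_ne_top μ _⟩
  exact h2 (Complex.ofReal_eq_zero.1 h1.symm)

/-- Characters separate a closed subgroup from the points outside: otherwise the means over `H` and
over `x H` would agree on all characters, hence on all continuous functions. -/
theorem exists_character_ne_one (hsep : ∀ x : G, x ≠ 1 → ∃ χ : G →ₜ* Circle, χ x ≠ 1)
    (H : Subgroup G) (hH : IsClosed (H : Set G)) {x : G} (hx : x ∉ H) :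
    ∃ χ : G →ₜ* Circle, (∀ h ∈ H, χ h = 1) ∧ χ x ≠ 1 := by
  by_contra! hcon
  have : CompactSpace H := isCompact_iff_compactSpace.1 hH.isCompact
  let _ : MeasurableSpace H := borel H
  have : BorelSpace H := ⟨rfl⟩
  let μ : Measure H := Measure.haar
  let j : C(H, G) := ⟨Subtype.val, continuous_subtype_val⟩
  let jx : C(H, G) := ⟨fun h => x * h, by fun_prop⟩
  let pull (i : C(H, G)) : C(G, ℂ) →L[ℂ] C(H, ℂ) :=
    ⟨(ContinuousMap.compRightAlgHom ℂ ℂ i).toLinearMap,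
      ContinuousMap.compRightAlgHom_continuous _ _ i⟩
  let I := ContinuousMap.integralFunctional μ
  have hL : I.comp (pull jx) - I.comp (pull j) = 0 := by
    refine clm_eq_zero_of_characters hsep (ContinuousMap.id G) Function.injective_id _ fun χ => ?_
    have h1 : I (pull jx χ.toComplex) = (χ x : ℂ) * I (pull j χ.toComplex) := by
      refine Eq.trans ?_ (integral_const_mul (χ x : ℂ) fun h : H => (χ h : ℂ))
      refine integral_congr_ae (Filter.Eventually.of_forall fun h => ?_)
      change ((χ (x * h) : Circle) : ℂ) = _
      rw [map_mul, Circle.coe_mul]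
    have h2 : I (pull jx χ.toComplex) - I (pull j χ.toComplex) = 0 := by
      by_cases hχ : ∀ h ∈ H, χ h = 1
      · rw [h1, hcon χ hχ, Circle.coe_one, one_mul, sub_self]
      · push Not at hχ
        obtain ⟨k, hk, hk1⟩ := hχ
        have h0 : I (pull j χ.toComplex) = 0 :=
          integral_character_eq_zero μ (χ.comp ⟨H.subtype, continuous_subtype_val⟩) ⟨⟨k, hk⟩, hk1⟩
        rw [h1, h0, mul_zero, sub_self]
    exact h2
  have hdisj : Disjoint (H : Set G) ((fun g => x * g) '' H) := by
    rw [Set.disjoint_left]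
    rintro _ hg ⟨h, hh, rfl⟩
    exact hx ((Subgroup.mul_mem_cancel_right H hh).1 hg)
  obtain ⟨f, hf0, hf1, -⟩ := exists_continuous_zero_one_of_isClosed hH
    (hH.isCompact.image (continuous_const_mul x)).isClosed hdisj
  let F : C(G, ℂ) := ⟨fun g => (f g : ℂ), Complex.continuous_ofReal.comp f.continuous⟩
  have hF0 : I (pull j F) = 0 := by
    refine Eq.trans (integral_congr_ae (Filter.Eventually.of_forall fun h => ?_))
      (integral_zero H ℂ)
    change ((f h : ℝ) : ℂ) = 0
    rw [hf0 h.2]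
    simp
  have hF1 : I (pull jx F) = μ.real Set.univ := by
    have : I (pull jx F) = ∫ _ : H, (1 : ℂ) ∂μ := by
      refine integral_congr_ae (Filter.Eventually.of_forall fun h => ?_)
      change ((f (x * h) : ℝ) : ℂ) = 1
      rw [hf1 ⟨h, h.2, rfl⟩]
      simp
    rw [this]
    simp
  have h1 : I (pull jx F) - I (pull j F) = 0 := congrArg (fun M => M F) hL
  rw [hF0, hF1, sub_zero] at h1
  have h2 : μ.real Set.univ ≠ 0 := by
    rw [Measure.real, Ne, ENNReal.toReal_eq_zero_iff, not_or]
    exact ⟨(isOpen_univ.measure_pos μ Set.univ_nonempty).ne', measure_ne_top μ _⟩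
  exact h2 (by exact_mod_cast h1)

end Characters

namespace IsTorus

variable (G : Type u) [Group G] [TopologicalSpace G] [IsTorus G]

theorem compactSpace : CompactSpace G := by
  obtain ⟨r, ⟨e⟩⟩ := IsTorus.exists_equiv (G := G)
  exact e.symm.toHomeomorph.compactSpace

theorem t2Space : T2Space G := by
  obtain ⟨r, ⟨e⟩⟩ := IsTorus.exists_equiv (G := G)
  exact e.toHomeomorph.isEmbedding.t2Space

theorem isTopologicalGroup : IsTopologicalGroup G := by
  obtain ⟨r, ⟨e⟩⟩ := IsTorus.exists_equiv (G := G)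
  exact e.toHomeomorph.isInducing.topologicalGroup e.toMonoidHom

variable {G}

theorem mul_comm (a b : G) : a * b = b * a := by
  obtain ⟨r, ⟨e⟩⟩ := IsTorus.exists_equiv (G := G)
  exact e.injective (by rw [map_mul, map_mul, _root_.mul_comm])

theorem exists_character_ne_one (x : G) (hx : x ≠ 1) : ∃ χ : G →ₜ* Circle, χ x ≠ 1 := by
  obtain ⟨r, ⟨e⟩⟩ := IsTorus.exists_equiv (G := G)
  by_contra! h
  refine hx (e.injective ?_)
  ext1 i
  rw [map_one]
  exact h ⟨(Pi.evalMonoidHom (fun _ : Fin r => Circle) i).comp e.toMonoidHom,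
    (continuous_apply i).comp e.continuous⟩

end IsTorus

/-- Twisting the characters of a torus by a character `ψ` of finite image of a closed subgroup `H`,
without producing new characters that are trivial on the connected subgroup `K`. The twisted
character is `χ * β`, where `β` extends `ψ`, or `χ * β * η`, where `η` is trivial on `H` but not on
`K`; the latter is only needed when `K` is not contained in `H`, since `ψ` is trivial on connected
sets. The two cases are told apart by a Boolean. -/
theorem exists_character_twist {G : Type u} [Group G] [TopologicalSpace G] [IsTorus G]
    {K : Subgroup G} (hK : IsConnected (K : Set G)) {H : Subgroup G} (hH : IsClosed (H : Set G))
    (ψ : H →ₜ* Circle) (hψ : (Set.range ψ).Finite) :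
    ∃ (m : (G →ₜ* Circle) → (G →ₜ* Circle)) (b : (G →ₜ* Circle) → Bool),
      (∀ χ, ∀ h : H, m χ h = χ h * ψ h) ∧ (∀ χ θ, m χ = m θ → b χ = b θ → χ = θ) ∧
        ∀ χ : G →ₜ* Circle, (∃ k ∈ K, χ k ≠ 1) → ∃ k ∈ K, m χ k ≠ 1 := by
  have := IsTorus.compactSpace G
  have := IsTorus.t2Space G
  have := IsTorus.isTopologicalGroup G
  have hsep := IsTorus.exists_character_ne_one (G := G)
  obtain ⟨β, hβ⟩ := exists_character_extension hsep H hH ψ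
  by_cases hKH : K ≤ H
  · refine ⟨fun χ => χ * β, fun _ => true, fun χ h => ?_, fun χ θ h _ => mul_right_cancel h,
      fun χ ⟨k, hk, hχ⟩ => ⟨k, hk, ?_⟩⟩
    · rw [ContinuousMonoidHom.mul_apply, hβ]
    · have hconn : IsPreconnected (Set.range fun k : K => ψ ⟨k, hKH k.2⟩) := by
        have : PreconnectedSpace K := Subtype.preconnectedSpace hK.isPreconnected
        refine isPreconnected_range (ψ.continuous_toFun.comp ?_)
        exact Continuous.subtype_mk continuous_subtype_val _
      have hsub : (Set.range fun k : K => ψ ⟨k, hKH k.2⟩).Subsingleton :=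
        Set.not_nontrivial_iff.1 fun h => hconn.infinite_of_nontrivial h
          (hψ.subset (by rintro _ ⟨k, rfl⟩; exact ⟨_, rfl⟩))
      have h1 : ψ ⟨k, hKH hk⟩ = ψ 1 := hsub ⟨⟨k, hk⟩, rfl⟩ ⟨1, rfl⟩
      rw [ContinuousMonoidHom.mul_apply, hβ ⟨k, hKH hk⟩, h1, map_one, mul_one]
      exact hχ
  · obtain ⟨x, hxK, hxH⟩ := SetLike.not_le_iff_exists.1 hKH
    obtain ⟨η, hηH, hηx⟩ := exists_character_ne_one hsep H hH hxH
    classical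
    let good (χ : G →ₜ* Circle) : Prop := ∃ k ∈ K, χ k ≠ 1
    refine ⟨fun χ => if good (χ * β) then χ * β else χ * β * η, fun χ => decide (good (χ * β)),
      fun χ h => ?_, fun χ θ h hb => ?_, fun χ _ => ?_⟩
    · dsimp only
      split_ifs
      · rw [ContinuousMonoidHom.mul_apply, hβ]
      · rw [ContinuousMonoidHom.mul_apply, ContinuousMonoidHom.mul_apply, hβ, hηH h h.2, mul_one]
    · rw [decide_eq_decide] at hb
      dsimp only at h
      by_cases h1 : good (χ * β)
      · rw [if_pos h1, if_pos (hb.1 h1)] at h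
        exact mul_right_cancel h
      · rw [if_neg h1, if_neg fun h2 => h1 (hb.2 h2)] at h
        exact mul_right_cancel (mul_right_cancel h)
    · dsimp only
      split_ifs with h1
      · exact h1
      · refine ⟨x, hxK, ?_⟩
        have h2 : (χ * β) x = 1 := by
          by_contra h2
          exact h1 ⟨x, hxK, h2⟩
        rwa [ContinuousMonoidHom.mul_apply, h2, one_mul]

/-! ### Families of finitely supported vectors -/

section FiniteFamilies

variable {A : Type*} {T : Type*} [TopologicalSpace T]

/-- A continuous family of finitely supported vectors: the supports lie in a common finite set, and
the coordinates are continuous. For compact `T` these are the continuous maps to the colimit of the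
spaces `ℂ^S`, `S` finite. -/
def IsFiniteFamily (u : T → A →₀ ℂ) : Prop :=
  (∃ S : Finset A, ∀ t, (u t).support ⊆ S) ∧ ∀ a, Continuous fun t => u t a

namespace IsFiniteFamily

theorem const (v : A →₀ ℂ) : IsFiniteFamily fun _ : T => v :=
  ⟨⟨v.support, fun _ => subset_rfl⟩, fun _ => continuous_const⟩

theorem add {u v : T → A →₀ ℂ} (hu : IsFiniteFamily u) (hv : IsFiniteFamily v) :
    IsFiniteFamily fun t => u t + v t := by
  classical
  obtain ⟨⟨S, hS⟩, hu⟩ := hu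
  obtain ⟨⟨S', hS'⟩, hv⟩ := hv
  exact ⟨⟨S ∪ S', fun t => Finsupp.support_add.trans (Finset.union_subset_union (hS t) (hS' t))⟩,
    fun a => (hu a).add (hv a)⟩

theorem smul {c : T → ℂ} {u : T → A →₀ ℂ} (hc : Continuous c) (hu : IsFiniteFamily u) :
    IsFiniteFamily fun t => c t • u t := by
  obtain ⟨⟨S, hS⟩, hu⟩ := hu
  exact ⟨⟨S, fun t => Finsupp.support_smul.trans (hS t)⟩, fun a => hc.mul (hu a)⟩

theorem sum {ι : Type*} (s : Finset ι) {u : ι → T → A →₀ ℂ} (hu : ∀ i ∈ s, IsFiniteFamily (u i)) :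
    IsFiniteFamily fun t => ∑ i ∈ s, u i t := by
  classical
  induction s using Finset.induction_on with
  | empty => simpa using const 0
  | insert i s hi ih =>
    simp only [Finset.sum_insert hi]
    exact (hu i (Finset.mem_insert_self i s)).add
      (ih fun j hj => hu j (Finset.mem_insert_of_mem hj))

theorem comp {T' : Type*} [TopologicalSpace T'] {u : T → A →₀ ℂ} (hu : IsFiniteFamily u)
    {f : T' → T} (hf : Continuous f) : IsFiniteFamily fun t => u (f t) :=
  ⟨hu.1.imp fun _ hS t => hS (f t), fun a => (hu.2 a).comp hf⟩

/-- Evaluation of a family of linear maps on a family of vectors. -/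
theorem apply {B : Type*} {p : T → (A →₀ ℂ) →ₗ[ℂ] (B →₀ ℂ)}
    (hp : ∀ v, IsFiniteFamily fun t => p t v) {u : T → A →₀ ℂ} (hu : IsFiniteFamily u) :
    IsFiniteFamily fun t => p t (u t) := by
  obtain ⟨⟨S, hS⟩, hu⟩ := hu
  have h (t : T) : p t (u t) = ∑ a ∈ S, u t a • p t (Finsupp.single a 1) := by
    conv_lhs => rw [← Finsupp.sum_single (u t), Finsupp.sum_of_support_subset _ (hS t) _ (by simp)]
    rw [map_sum]
    refine Finset.sum_congr rfl fun a _ => ?_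
    rw [← _root_.map_smul, Finsupp.smul_single_one]
  simp only [h]
  exact sum S fun a _ => smul (hu a) (hp _)

theorem map {B : Type*} (L : (A →₀ ℂ) →ₗ[ℂ] (B →₀ ℂ)) {u : T → A →₀ ℂ}
    (hu : IsFiniteFamily u) : IsFiniteFamily fun t => L (u t) :=
  apply (p := fun _ => L) (fun v => const (L v)) hu

theorem apply_pi {B I : Type*} [Finite I] {p : T → (I → A →₀ ℂ) →ₗ[ℂ] (B →₀ ℂ)}
    (hp : ∀ v, IsFiniteFamily fun t => p t v) {u : T → I → A →₀ ℂ}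
    (hu : ∀ i, IsFiniteFamily fun t => u t i) : IsFiniteFamily fun t => p t (u t) := by
  classical
  cases nonempty_fintype I
  have h (t : T) : p t (u t) = ∑ i, (p t ∘ₗ LinearMap.single ℂ (fun _ => A →₀ ℂ) i) (u t i) := by
    conv_lhs => rw [← Finset.univ_sum_single (u t)]
    rw [map_sum]
    rfl
  simp only [h]
  exact sum _ fun i _ => apply (fun v => hp _) (hu i)

end IsFiniteFamily

/-- A compact set meets a set all of whose subsets are closed in a finite set. -/
theorem IsCompact.finite_inter_of_forall_isClosed {X : Type*} [TopologicalSpace X] {C D : Set X}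
    (hC : IsCompact C) (hD : ∀ E ⊆ D, IsClosed E) : (C ∩ D).Finite := by
  refine (hC.inter_right (hD D subset_rfl)).finite ?_
  refine isDiscrete_iff_discreteTopology.2 ?_
  refine discreteTopology_iff_forall_isClosed.2 fun E => ?_
  have h : E = Subtype.val ⁻¹' (Subtype.val '' E) :=
    (Set.preimage_image_eq E Subtype.val_injective).symm
  rw [h]
  refine (hD _ ?_).preimage continuous_subtype_val
  rintro _ ⟨x, _, rfl⟩
  exact x.2.2

/-- The compactness argument behind the fact that a compact subset of a colimit of spaces `ℂ^S`, or
of spheres `S^{ℂ^S}`, lies in a single one of them: if the supports of a compact family are not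
contained in a finite set, the family takes infinitely many values in a set all of whose subsets
are closed. -/
theorem exists_finset_support_subset {A X T : Type*} [TopologicalSpace X] [TopologicalSpace T]
    [CompactSpace T] {p : T → X} (hp : Continuous p) (val : X → A →₀ ℂ)
    (hX : ∀ E : Set X, (∀ S : Finset A, {x ∈ E | (val x).support ⊆ S}.Finite) → IsClosed E) :
    ∃ S : Finset A, ∀ t, (val (p t)).support ⊆ S := by
  classical
  let B : Set A := ⋃ t, (val (p t)).support
  have hB : ∀ b : B, ∃ t, (b : A) ∈ (val (p t)).support := fun b =>
    Set.mem_iUnion.1 b.2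
  choose τ hτ using hB
  let D : Set X := Set.range fun b => p (τ b)
  have hD : ∀ E ⊆ D, IsClosed E := by
    refine fun E hE => hX E fun S => ?_
    have hfin : {b : B | (b : A) ∈ S}.Finite :=
      Set.Finite.preimage Subtype.val_injective.injOn S.finite_toSet
    refine (hfin.image fun b => p (τ b)).subset ?_
    rintro x ⟨hx, hxS⟩
    obtain ⟨b, rfl⟩ := hE hx
    exact ⟨b, hxS (hτ b), rfl⟩
  have hfin : D.Finite := by
    refine ((isCompact_range hp).finite_inter_of_forall_isClosed hD).subset fun x hx => ⟨?_, hx⟩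
    obtain ⟨b, rfl⟩ := hx
    exact ⟨_, rfl⟩
  refine ⟨hfin.toFinset.biUnion fun x => (val x).support, fun t a ha => ?_⟩
  have haB : a ∈ B := Set.mem_iUnion.2 ⟨t, ha⟩
  rw [Finset.mem_biUnion]
  exact ⟨p (τ ⟨a, haB⟩), hfin.mem_toFinset.2 ⟨⟨a, haB⟩, rfl⟩, hτ ⟨a, haB⟩⟩

end FiniteFamilies

/-! ### Spaces of injective linear operations -/

/-- The injective linear maps `(ℂ^(A))^I → ℂ^(A)` that map vectors supported in `s` to vectors
supported in `s`. -/
structure LinearOperation {A : Type u} (s : Set A) (I : Type) : Type u where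
  toLinearMap : (I → A →₀ ℂ) →ₗ[ℂ] (A →₀ ℂ)
  injective : Function.Injective toLinearMap
  supported : ∀ y, (∀ i, y i ∈ Finsupp.supported ℂ ℂ s) → toLinearMap y ∈ Finsupp.supported ℂ ℂ s

namespace LinearOperation

variable {A : Type u} {s : Set A} {I : Type}

theorem ext_apply {f g : LinearOperation s I} (h : ∀ y, f.toLinearMap y = g.toLinearMap y) :
    f = g := by
  cases f
  cases g
  congr
  exact LinearMap.ext h

/-- A family of operations is continuous if it is so on every vector. -/
def IsFamily {T : Type*} [TopologicalSpace T] (p : T → LinearOperation s I) : Prop :=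
  ∀ y, IsFiniteFamily fun t => (p t).toLinearMap y

theorem IsFamily.comp {T T' : Type*} [TopologicalSpace T] [TopologicalSpace T']
    {p : T → LinearOperation s I} (hp : IsFamily p) {f : T' → T} (hf : Continuous f) :
    IsFamily fun t => p (f t) :=
  fun y => (hp y).comp hf

/-- The finest topology for which the continuous families over compact Hausdorff spaces are
continuous. -/
instance : TopologicalSpace (LinearOperation s I) where
  IsOpen V := ∀ (T : Type u) [TopologicalSpace T] [CompactSpace T] [T2Space T]
    (p : T → LinearOperation s I), IsFamily p → IsOpen (p ⁻¹' V)
  isOpen_univ _ _ _ _ _ _ := isOpen_univ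
  isOpen_inter _ _ hV hW T _ _ _ p hp := (hV T p hp).inter (hW T p hp)
  isOpen_sUnion 𝒱 h𝒱 T _ _ _ p hp := by
    rw [Set.preimage_sUnion]
    exact isOpen_biUnion fun _ hV => h𝒱 _ hV T p hp

theorem IsFamily.continuous {T : Type u} [TopologicalSpace T] [CompactSpace T] [T2Space T]
    {p : T → LinearOperation s I} (hp : IsFamily p) : Continuous p :=
  continuous_def.2 fun _ hV => hV T p hp

theorem continuous_dom {Z : Type*} [TopologicalSpace Z] {F : LinearOperation s I → Z}
    (h : ∀ (T : Type u) [TopologicalSpace T] [CompactSpace T] [T2Space T]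
      (p : T → LinearOperation s I), IsFamily p → Continuous fun t => F (p t)) :
    Continuous F :=
  continuous_def.2 fun _ hV T _ _ _ p hp => hV.preimage (h T p hp)

theorem continuous_prod_dom {Y : Type*} {Z : Type u} [TopologicalSpace Y] [TopologicalSpace Z]
    [CompactSpace Z] [T2Space Z] {F : LinearOperation s I × Z → Y}
    (h : ∀ (T : Type u) [TopologicalSpace T] [CompactSpace T] [T2Space T]
      (p : T → LinearOperation s I), IsFamily p → Continuous fun q : T × Z => F (p q.1, q.2)) :
    Continuous F := by
  have hF (f : LinearOperation s I) : Continuous fun z => F (f, z) := by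
    have h1 := h PUnit (fun _ => f) (fun y => .const _)
    exact h1.comp (Continuous.prodMk_right PUnit.unit)
  let Φ : LinearOperation s I → C(Z, Y) := fun f => ⟨fun z => F (f, z), hF f⟩
  have hΦ : Continuous Φ := continuous_dom fun T _ _ _ p hp =>
    ContinuousMap.continuous_of_continuous_uncurry _ (h T p hp)
  exact ContinuousMap.continuous_uncurry_of_continuous ⟨Φ, hΦ⟩

theorem continuous_apply (y : I → A →₀ ℂ) (a : A) :
    Continuous fun f : LinearOperation s I => f.toLinearMap y a :=
  continuous_dom fun _ _ _ _ _ hp => (hp y).2 a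

instance : T2Space (LinearOperation s I) := by
  refine ⟨fun f g hfg => ?_⟩
  have h : ∃ y a, f.toLinearMap y a ≠ g.toLinearMap y a := by
    by_contra! h
    exact hfg (ext_apply fun y => Finsupp.ext (h y))
  obtain ⟨y, a, h⟩ := h
  exact separated_by_continuous (continuous_apply y a) h

theorem isFamily_of_continuous {T : Type u} [TopologicalSpace T] [CompactSpace T] [T2Space T]
    {p : T → LinearOperation s I} (hp : Continuous p) : IsFamily p := by
  refine fun y => ⟨?_, fun a => (continuous_apply y a).comp hp⟩
  refine exists_finset_support_subset hp (fun f => f.toLinearMap y) fun E hE => ?_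
  refine isOpen_compl_iff.1 fun T' _ _ _ q hq => ?_
  obtain ⟨S, hS⟩ := (hq y).1
  have h : q ⁻¹' Eᶜ = (q ⁻¹' {f ∈ E | (f.toLinearMap y).support ⊆ S})ᶜ := by
    ext t
    simp [hS t]
  rw [h]
  exact ((hE S).isClosed.preimage hq.continuous).isOpen_compl

instance : CompactlyGeneratedSpace (LinearOperation s I) :=
  compactlyGeneratedSpace_of_isOpen fun _ h T _ _ _ p hp => h T p hp.continuous

theorem isWeaklyHausdorff : IsWeaklyHausdorff (LinearOperation s I) :=
  fun _ _ _ _ _ hf => (isCompact_range hf).isClosed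

end LinearOperation

/-! ### The operad of linear operations -/

section Rotation

variable (G : Type u) [Group G] [TopologicalSpace G]

/-- The indices of the coordinates of the complete universe. -/
abbrev CharIndex : Type u := (G →ₜ* Circle) × ℕ

variable {G}

/-- The indices of the coordinates on which `K` acts nontrivially. -/
def freeIndex (K : Subgroup G) : Set (CharIndex G) := {a | ∃ k ∈ K, a.1 k ≠ 1}

/-- The action of `g` on the complete universe, as a complex linear map. -/
noncomputable def rotate (g : G) : (CharIndex G →₀ ℂ) →ₗ[ℂ] (CharIndex G →₀ ℂ) where
  toFun u :=
    { support := u.support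
      toFun := fun a => (a.1 g : ℂ) * u a
      mem_support_toFun := fun a => by simp }
  map_add' u v := by ext a; simp [mul_add]
  map_smul' c u := by ext a; simp [mul_left_comm]

@[simp]
theorem rotate_apply (g : G) (u : CharIndex G →₀ ℂ) (a : CharIndex G) :
    rotate g u a = (a.1 g : ℂ) * u a := rfl

@[simp]
theorem rotate_one (u : CharIndex G →₀ ℂ) : rotate (1 : G) u = u := by
  ext a; simp

theorem rotate_mul (g h : G) (u : CharIndex G →₀ ℂ) :
    rotate (g * h) u = rotate g (rotate h u) := by
  ext a; simp [mul_assoc]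

@[simp]
theorem rotate_inv_rotate (g : G) (u : CharIndex G →₀ ℂ) : rotate g⁻¹ (rotate g u) = u := by
  rw [← rotate_mul, inv_mul_cancel, rotate_one]

@[simp]
theorem rotate_rotate_inv (g : G) (u : CharIndex G →₀ ℂ) : rotate g (rotate g⁻¹ u) = u := by
  rw [← rotate_mul, mul_inv_cancel, rotate_one]

theorem rotate_injective (g : G) : Function.Injective (rotate g) :=
  Function.LeftInverse.injective (rotate_inv_rotate g)

theorem rotate_mem_supported (g : G) {s : Set (CharIndex G)} {u : CharIndex G →₀ ℂ}
    (hu : u ∈ Finsupp.supported ℂ ℂ s) : rotate g u ∈ Finsupp.supported ℂ ℂ s := hu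

theorem IsFiniteFamily.rotate {T : Type*} [TopologicalSpace T] {g : T → G} (hg : Continuous g)
    {u : T → CharIndex G →₀ ℂ} (hu : IsFiniteFamily u) :
    IsFiniteFamily fun t => rotate (g t) (u t) :=
  ⟨hu.1, fun a => (continuous_subtype_val.comp (a.1.continuous_toFun.comp hg)).mul (hu.2 a)⟩

end Rotation

namespace LinearOperation

section Operad

variable {A : Type u} {s : Set A}

/-- Renaming of the inputs. -/
noncomputable def relabel {I J : Type} (e : I ≃ J) (f : LinearOperation s I) :
    LinearOperation s J where
  toLinearMap := f.toLinearMap ∘ₗ LinearMap.funLeft ℂ (A →₀ ℂ) e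
  injective := f.injective.comp (LinearMap.funLeft_injective_of_surjective ℂ _ _ e.surjective)
  supported _ hy := f.supported _ fun i => hy (e i)

/-- The identity operation. -/
noncomputable def one (s : Set A) : LinearOperation s Unit where
  toLinearMap := LinearMap.proj ()
  injective _ _ h := by ext1; exact h
  supported _ hy := hy ()

/-- Composition of operations. -/
noncomputable def comp {I : Type} {J : I → Type} (f : LinearOperation s I)
    (g : ∀ i, LinearOperation s (J i)) : LinearOperation s (Σ i, J i) where
  toLinearMap := f.toLinearMap ∘ₗ LinearMap.pi fun i =>
    (g i).toLinearMap ∘ₗ LinearMap.funLeft ℂ (A →₀ ℂ) (Sigma.mk i)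
  injective _ _ h := by
    ext1 ⟨i, j⟩
    exact congrFun ((g i).injective (congrFun (f.injective h) i)) j
  supported y hy := f.supported _ fun i => (g i).supported _ fun j => hy ⟨i, j⟩

theorem IsFamily.comp_comp {T : Type*} [TopologicalSpace T] {I : Type} {J : I → Type} [Finite I]
    [∀ i, Finite (J i)] {f : T → LinearOperation s I} {g : ∀ i, T → LinearOperation s (J i)}
    (hf : IsFamily f) (hg : ∀ i, IsFamily (g i)) :
    IsFamily fun t => (f t).comp fun i => g i t :=
  fun _ => IsFiniteFamily.apply_pi (p := fun t => (f t).toLinearMap) hf fun i => hg i _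

end Operad

section Group

variable {G : Type u} [Group G] [TopologicalSpace G] {s : Set (CharIndex G)} {I : Type}

/-- The conjugation action. -/
noncomputable instance : MulAction G (LinearOperation s I) where
  smul g f :=
    { toLinearMap :=
        rotate g ∘ₗ f.toLinearMap ∘ₗ LinearMap.pi fun i => rotate g⁻¹ ∘ₗ LinearMap.proj i
      injective := fun _ _ h => by
        ext1 i
        exact rotate_injective g⁻¹ (congrFun (f.injective (rotate_injective g h)) i)
      supported := fun _ hy => rotate_mem_supported g
        (f.supported _ fun i => rotate_mem_supported g⁻¹ (hy i)) }
  one_smul f := ext_apply fun y => by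
    change rotate 1 (f.toLinearMap fun i => rotate 1⁻¹ (y i)) = _
    simp
  mul_smul g h f := ext_apply fun y => by
    change rotate (g * h) (f.toLinearMap fun i => rotate (g * h)⁻¹ (y i)) =
      rotate g (rotate h (f.toLinearMap fun i => rotate h⁻¹ (rotate g⁻¹ (y i))))
    simp [rotate_mul]

theorem smul_apply (g : G) (f : LinearOperation s I) (y : I → CharIndex G →₀ ℂ) :
    (g • f).toLinearMap y = rotate g (f.toLinearMap fun i => rotate g⁻¹ (y i)) := rfl

theorem IsFamily.smul {T : Type*} [TopologicalSpace T] [ContinuousInv G] [Finite I] {g : T → G}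
    (hg : Continuous g) {p : T → LinearOperation s I} (hp : IsFamily p) :
    IsFamily fun t => g t • p t := fun y =>
  .rotate hg (IsFiniteFamily.apply_pi (p := fun t => (p t).toLinearMap) hp fun i =>
    .rotate (continuous_inv.comp hg) (.const (y i)))

theorem isGSpace [IsTorus G] [Finite I] : IsGSpace G (LinearOperation s I) := by
  have := IsTorus.compactSpace G
  have := IsTorus.t2Space G
  have := IsTorus.isTopologicalGroup G
  refine { continuous_smul := ?_, compactlyGenerated := inferInstance,
           weaklyHausdorff := isWeaklyHausdorff }
  refine Continuous.comp (g := fun q : LinearOperation s I × G => q.2 • q.1) ?_ continuous_swap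
  exact continuous_prod_dom fun T _ _ _ p hp =>
    (IsFamily.smul continuous_snd (hp.comp continuous_fst)).continuous

end Group

end LinearOperation

theorem KContinuous.of_comp {X Z : Type u} [TopologicalSpace X] [TopologicalSpace Z] {f : X → Z}
    (h : ∀ (T : Type u) [TopologicalSpace T] [CompactSpace T] [T2Space T] (p : T → X),
      Continuous p → Continuous fun t => f (p t)) : KContinuous f :=
  continuous_from_compactlyGenerated f fun S g => h S g g.continuous

open LinearOperation in
/-- The operad of the injective linear maps `(ℂ^(A))^I → ℂ^(A)`, `A` the set of coordinates of the
complete universe, which preserve the vectors supported in `s`. -/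
noncomputable def linearOperad (G : Type u) [Group G] [TopologicalSpace G] [IsTorus G]
    (s : Set (CharIndex G)) : GOperad G where
  obj I _ := LinearOperation s I
  isGSpace _ _ := LinearOperation.isGSpace
  relabel e f := f.relabel e
  continuous_relabel e := continuous_dom fun T _ _ _ p hp =>
    IsFamily.continuous fun y => hp (fun i => y (e i))
  relabel_smul _ _ _ := rfl
  relabel_refl _ := rfl
  relabel_trans _ _ _ := rfl
  one := .one s
  smul_one g := ext_apply fun y => rotate_rotate_inv g (y ())
  comp f g := f.comp g
  kcontinuous_comp := .of_comp fun T _ _ _ p hp => IsFamily.continuous <|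
    IsFamily.comp_comp (isFamily_of_continuous (continuous_fst.comp hp)) fun i =>
      isFamily_of_continuous ((_root_.continuous_apply i).comp (continuous_snd.comp hp))
  comp_smul g a b := ext_apply fun y => by
    change rotate g (a.toLinearMap fun i => rotate g⁻¹ (rotate g _)) = _
    simp only [rotate_inv_rotate]
    rfl
  comp_relabel_right _ _ _ := rfl
  comp_relabel_left e a b := rfl
  one_comp b := rfl
  comp_one a := rfl
  comp_assoc a b c := rfl

/-! ### Contractibility of the spaces of fixed operations -/

section Shift

variable {G : Type u} [Group G] [TopologicalSpace G]

/-- The linear map which permutes the coordinates by an arbitrary map of the indices. -/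
noncomputable def reindex (m : CharIndex G → CharIndex G) :
    (CharIndex G →₀ ℂ) →ₗ[ℂ] (CharIndex G →₀ ℂ) :=
  Finsupp.lmapDomain ℂ ℂ m

theorem reindex_injective {m : CharIndex G → CharIndex G} (hm : Function.Injective m) :
    Function.Injective (reindex m) := Finsupp.mapDomain_injective hm

theorem reindex_apply {m : CharIndex G → CharIndex G} (hm : Function.Injective m)
    (u : CharIndex G →₀ ℂ) (a : CharIndex G) : reindex m u (m a) = u a :=
  Finsupp.mapDomain_apply hm u a

theorem reindex_of_notMem_range {m : CharIndex G → CharIndex G} (u : CharIndex G →₀ ℂ)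
    {a : CharIndex G} (ha : a ∉ Set.range m) : reindex m u a = 0 :=
  Finsupp.mapDomain_of_notMem_range u a ha

theorem reindex_mem_supported {m : CharIndex G → CharIndex G} {s : Set (CharIndex G)}
    (hm : ∀ a ∈ s, m a ∈ s) {u : CharIndex G →₀ ℂ} (hu : u ∈ Finsupp.supported ℂ ℂ s) :
    reindex m u ∈ Finsupp.supported ℂ ℂ s := by
  classical
  intro a ha
  obtain ⟨b, hb, rfl⟩ := Finset.mem_image.1 (Finsupp.mapDomain_support ha)
  exact hm b (hu hb)

/-- If `m` multiplies the characters by a fixed number at `g`, then so does `reindex m` with the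
action of `g`. -/
theorem rotate_reindex {m : CharIndex G → CharIndex G} {g : G} {c : ℂ}
    (hm : ∀ a, ((m a).1 g : ℂ) = c * (a.1 g : ℂ)) (u : CharIndex G →₀ ℂ) :
    rotate g (reindex m u) = c • reindex m (rotate g u) := by
  have h : rotate g ∘ₗ reindex m = c • (reindex m ∘ₗ rotate g) := by
    ext a b
    have h1 (d : CharIndex G) : rotate g (Finsupp.single d 1) = Finsupp.single d (d.1 g : ℂ) := by
      classical
      ext b
      rw [rotate_apply, Finsupp.single_apply, Finsupp.single_apply]
      split_ifs with h
      · rw [h, mul_one]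
      · rw [mul_zero]
    simp [reindex, h1, Finsupp.mapDomain_single, hm]
  exact LinearMap.congr_fun h u

/-- The shift of the second index to the odd numbers. It has no cycles, since it increases the
index. -/
def oddIndex (a : CharIndex G) : CharIndex G := (a.1, 2 * a.2 + 1)

/-- The shift of the second index to positive even numbers. Its image is disjoint from that of
`oddIndex`. -/
def evenIndex (a : CharIndex G) : CharIndex G := (a.1, 2 * a.2 + 2)

theorem oddIndex_injective : Function.Injective (oddIndex (G := G)) := by
  rintro ⟨χ, n⟩ ⟨θ, k⟩ h
  simp only [oddIndex, Prod.mk.injEq] at h ⊢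
  exact ⟨h.1, by omega⟩

theorem evenIndex_injective : Function.Injective (evenIndex (G := G)) := by
  rintro ⟨χ, n⟩ ⟨θ, k⟩ h
  simp only [evenIndex, Prod.mk.injEq] at h ⊢
  exact ⟨h.1, by omega⟩

theorem oddIndex_ne_evenIndex (a b : CharIndex G) : oddIndex a ≠ evenIndex b := by
  intro h
  have := congrArg Prod.snd h
  simp only [oddIndex, evenIndex] at this
  omega

/-- The linear path from the identity to the odd shift. -/
noncomputable def slide (t : ℝ) : (CharIndex G →₀ ℂ) →ₗ[ℂ] (CharIndex G →₀ ℂ) :=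
  ((1 - t : ℝ) : ℂ) • LinearMap.id + (t : ℂ) • reindex oddIndex

theorem slide_apply (t : ℝ) (u : CharIndex G →₀ ℂ) :
    slide t u = ((1 - t : ℝ) : ℂ) • u + (t : ℂ) • reindex oddIndex u := rfl

theorem slide_injective (t : ℝ) : Function.Injective (slide (G := G) t) := by
  refine (injective_iff_map_eq_zero _).2 fun u hu => ?_
  rw [slide_apply] at hu
  by_cases ht : t = 1
  · subst ht
    refine (injective_iff_map_eq_zero _).1 (reindex_injective oddIndex_injective) u ?_
    simpa using hu
  -- The coordinates vanish one after the other, as the shift increases the second index.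
  · ext ⟨χ, n⟩
    induction n using Nat.strong_induction_on with
    | _ n ih =>
      have h := DFunLike.congr_fun hu (χ, n)
      have h0 : reindex oddIndex u (χ, n) = 0 := by
        by_cases hn : (χ, n) ∈ Set.range (oddIndex (G := G))
        · obtain ⟨⟨θ, k⟩, hk⟩ := hn
          rw [← hk, reindex_apply oddIndex_injective]
          simp only [oddIndex, Prod.mk.injEq] at hk
          rw [hk.1]
          exact ih k (by omega)
        · exact reindex_of_notMem_range u hn
      rw [Finsupp.add_apply, Finsupp.smul_apply, Finsupp.smul_apply, h0, smul_zero, add_zero,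
        smul_eq_mul, Finsupp.coe_zero, Pi.zero_apply, mul_eq_zero] at h
      refine h.resolve_left fun h => ht ?_
      have := Complex.ofReal_eq_zero.1 h
      linarith

end Shift

namespace LinearOperation

variable {G : Type u} [Group G] [TopologicalSpace G] {K : Subgroup G}

/-- Fixed points of a subgroup of `G × Σ_I` in terms of values. -/
def IsFixed {s : Set (CharIndex G)} {I : Type} (Γ : Subgroup (G × Equiv.Perm I))
    (f : LinearOperation s I) : Prop :=
  ∀ γ ∈ Γ, ∀ y, rotate γ.1 (f.toLinearMap fun i => rotate γ.1⁻¹ (y (γ.2 i))) = f.toLinearMap y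

theorem isFixed_iff {s : Set (CharIndex G)} {I : Type} {Γ : Subgroup (G × Equiv.Perm I)}
    {f : LinearOperation s I} : IsFixed Γ f ↔ ∀ γ ∈ Γ, γ.1 • f.relabel γ.2 = f :=
  forall₂_congr fun _ _ => ⟨fun h => ext_apply h, fun h y => by
    conv_rhs => rw [← h]
    rfl⟩

/-- Composition of `f` with the path `slide`. -/
noncomputable def slideComp {I : Type} (t : ℝ) (f : LinearOperation (freeIndex K) I) :
    LinearOperation (freeIndex K) I where
  toLinearMap := slide t ∘ₗ f.toLinearMap
  injective := (slide_injective t).comp f.injective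
  supported y hy := by
    have h := f.supported y hy
    exact add_mem (Submodule.smul_mem _ _ h)
      (Submodule.smul_mem _ _ (reindex_mem_supported (m := oddIndex) (fun _ ha => ha) h))

/-- The linear path from the odd shift of `f` to the even shift of `f₀`. -/
noncomputable def join {I : Type} (t : ℝ) (f f₀ : LinearOperation (freeIndex K) I) :
    LinearOperation (freeIndex K) I where
  toLinearMap := ((1 - t : ℝ) : ℂ) • (reindex oddIndex ∘ₗ f.toLinearMap) +
    (t : ℂ) • (reindex evenIndex ∘ₗ f₀.toLinearMap)
  injective := by
    refine (injective_iff_map_eq_zero _).2 fun y hy => ?_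
    change ((1 - t : ℝ) : ℂ) • reindex oddIndex (f.toLinearMap y) +
      (t : ℂ) • reindex evenIndex (f₀.toLinearMap y) = 0 at hy
    by_cases ht : t = 0
    · subst ht
      refine (injective_iff_map_eq_zero _).1 f.injective y ?_
      refine (injective_iff_map_eq_zero _).1 (reindex_injective oddIndex_injective) _ ?_
      simpa using hy
    · refine (injective_iff_map_eq_zero _).1 f₀.injective y ?_
      ext a
      have h := DFunLike.congr_fun hy (evenIndex a)
      rw [Finsupp.add_apply, Finsupp.smul_apply, Finsupp.smul_apply,
        reindex_apply evenIndex_injective, reindex_of_notMem_range, smul_zero, zero_add] at h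
      · exact (mul_eq_zero.1 h).resolve_left (Complex.ofReal_ne_zero.2 ht)
      · rintro ⟨b, hb⟩
        exact oddIndex_ne_evenIndex b a hb
  supported y hy := add_mem
    (Submodule.smul_mem _ _
      (reindex_mem_supported (m := oddIndex) (fun _ ha => ha) (f.supported y hy)))
    (Submodule.smul_mem _ _
      (reindex_mem_supported (m := evenIndex) (fun _ ha => ha) (f₀.supported y hy)))

theorem rotate_oddIndex (g : G) (u : CharIndex G →₀ ℂ) :
    rotate g (reindex oddIndex u) = reindex oddIndex (rotate g u) := by
  rw [rotate_reindex (c := 1) (by simp [oddIndex]), one_smul]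

theorem rotate_evenIndex (g : G) (u : CharIndex G →₀ ℂ) :
    rotate g (reindex evenIndex u) = reindex evenIndex (rotate g u) := by
  rw [rotate_reindex (c := 1) (by simp [evenIndex]), one_smul]

theorem IsFixed.slideComp {I : Type} {Γ : Subgroup (G × Equiv.Perm I)}
    {f : LinearOperation (freeIndex K) I} (hf : IsFixed Γ f) (t : ℝ) :
    IsFixed Γ (f.slideComp t) := fun γ hγ y => by
  change rotate γ.1 (slide t _) = slide t (f.toLinearMap y)
  rw [← hf γ hγ y]
  simp [slide_apply, rotate_oddIndex]

theorem IsFixed.join {I : Type} {Γ : Subgroup (G × Equiv.Perm I)}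
    {f f₀ : LinearOperation (freeIndex K) I} (hf : IsFixed Γ f) (hf₀ : IsFixed Γ f₀) (t : ℝ) :
    IsFixed Γ (f.join t f₀) := fun γ hγ y => by
  change rotate γ.1 (((1 - t : ℝ) : ℂ) • reindex oddIndex (f.toLinearMap _) +
      (t : ℂ) • reindex evenIndex (f₀.toLinearMap _)) =
    ((1 - t : ℝ) : ℂ) • reindex oddIndex (f.toLinearMap y) +
      (t : ℂ) • reindex evenIndex (f₀.toLinearMap y)
  rw [← hf γ hγ y, ← hf₀ γ hγ y]
  simp [rotate_oddIndex, rotate_evenIndex]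

theorem continuous_unitInterval {s : Set (CharIndex G)} {I J : Type}
    {F : unitInterval → LinearOperation s I → LinearOperation s J}
    (hF : ∀ (T : Type u) [TopologicalSpace T] (τ : T → unitInterval) (p : T → LinearOperation s I),
      Continuous τ → IsFamily p → IsFamily fun t => F (τ t) (p t)) :
    Continuous fun q : unitInterval × LinearOperation s I => F q.1 q.2 := by
  have h : Continuous fun q : LinearOperation s I × ULift.{u} unitInterval => F q.2.down q.1 :=
    continuous_prod_dom fun T _ _ _ p hp =>
      (hF (T × ULift.{u} unitInterval) (fun q => q.2.down) _
        (continuous_uliftDown.comp continuous_snd) (hp.comp continuous_fst)).continuous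
  exact h.comp (continuous_snd.prodMk (continuous_uliftUp.comp continuous_fst))

theorem continuous_slideComp {I : Type} :
    Continuous fun q : unitInterval × LinearOperation (freeIndex K) I => q.2.slideComp q.1 := by
  refine continuous_unitInterval (F := fun t f => f.slideComp t) fun T _ τ p hτ hp y => ?_
  have hc : Continuous fun t => (τ t : ℝ) := continuous_subtype_val.comp hτ
  exact ((hp y).smul (Complex.continuous_ofReal.comp (continuous_const.sub hc))).add
    (((hp y).map _).smul (Complex.continuous_ofReal.comp hc))

theorem continuous_join {I : Type} (f₀ : LinearOperation (freeIndex K) I) :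
    Continuous fun q : unitInterval × LinearOperation (freeIndex K) I => q.2.join q.1 f₀ := by
  refine continuous_unitInterval (F := fun t f => f.join t f₀) fun T _ τ p hτ hp y => ?_
  have hc : Continuous fun t => (τ t : ℝ) := continuous_subtype_val.comp hτ
  have h₁ : IsFiniteFamily fun t =>
      ((1 - (τ t : ℝ) : ℝ) : ℂ) • reindex oddIndex ((p t).toLinearMap y) :=
    ((hp y).map _).smul (Complex.continuous_ofReal.comp (continuous_const.sub hc))
  have h₂ : IsFiniteFamily fun t => ((τ t : ℝ) : ℂ) • reindex evenIndex (f₀.toLinearMap y) :=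
    (IsFiniteFamily.const _).smul (Complex.continuous_ofReal.comp hc)
  exact h₁.add h₂

/-- The identity of a fixed point space moves to the odd shift, and then to a constant even
shift. -/
theorem contractibleSpace_isFixed {I : Type} {Γ : Subgroup (G × Equiv.Perm I)}
    {f₀ : LinearOperation (freeIndex K) I} (hf₀ : IsFixed Γ f₀) :
    ContractibleSpace {f : LinearOperation (freeIndex K) I | IsFixed Γ f} := by
  let X := {f : LinearOperation (freeIndex K) I | IsFixed Γ f}
  let H₁ : C(unitInterval × X, X) :=
    ⟨fun q => ⟨q.2.1.slideComp q.1, q.2.2.slideComp q.1⟩, Continuous.subtype_mk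
      (continuous_slideComp.comp (continuous_fst.prodMk (continuous_subtype_val.comp
        continuous_snd))) _⟩
  let H₂ : C(unitInterval × X, X) :=
    ⟨fun q => ⟨q.2.1.join q.1 f₀, q.2.2.join hf₀ q.1⟩, Continuous.subtype_mk
      ((continuous_join f₀).comp (continuous_fst.prodMk (continuous_subtype_val.comp
        continuous_snd))) _⟩
  let mid : C(X, X) := H₁.comp ⟨fun x => (1, x), by fun_prop⟩
  have e₁ : (ContinuousMap.id X).Homotopic mid := ⟨
    { toContinuousMap := H₁
      map_zero_left := fun f => Subtype.ext (ext_apply fun y => by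
        change slide ((0 : unitInterval) : ℝ) (f.1.toLinearMap y) = f.1.toLinearMap y
        simp [slide_apply])
      map_one_left := fun f => rfl }⟩
  have e₂ : mid.Homotopic (ContinuousMap.const X (H₂ (1, ⟨f₀, hf₀⟩))) := ⟨
    { toContinuousMap := H₂
      map_zero_left := fun f => Subtype.ext (ext_apply fun y => by
        change ((1 - ((0 : unitInterval) : ℝ) : ℝ) : ℂ) • reindex oddIndex (f.1.toLinearMap y) +
          (((0 : unitInterval) : ℝ) : ℂ) • reindex evenIndex (f₀.toLinearMap y) =
            slide ((1 : unitInterval) : ℝ) (f.1.toLinearMap y)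
        simp [slide_apply])
      map_one_left := fun f => Subtype.ext (ext_apply fun y => by
        change ((1 - ((1 : unitInterval) : ℝ) : ℝ) : ℂ) • reindex oddIndex (f.1.toLinearMap y) +
          (((1 : unitInterval) : ℝ) : ℂ) • reindex evenIndex (f₀.toLinearMap y) =
          ((1 - ((1 : unitInterval) : ℝ) : ℝ) : ℂ) • reindex oddIndex (f₀.toLinearMap y) +
          (((1 : unitInterval) : ℝ) : ℂ) • reindex evenIndex (f₀.toLinearMap y)
        simp) }⟩
  exact (contractible_iff_id_nullhomotopic X).2 ⟨_, e₁.trans e₂⟩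

/-- An injective operation is not invariant under a nontrivial permutation of its inputs. -/
theorem not_isFixed {s : Set (CharIndex G)} {I : Type} {Γ : Subgroup (G × Equiv.Perm I)}
    {σ : Equiv.Perm I} (hσ : ((1 : G), σ) ∈ Γ) (hσ1 : σ ≠ 1) (f : LinearOperation s I) :
    ¬ IsFixed Γ f := by
  classical
  intro hf
  obtain ⟨i, hi⟩ : ∃ i, σ i ≠ i := by
    by_contra! h
    exact hσ1 (Equiv.ext h)
  let v : CharIndex G →₀ ℂ := Finsupp.single (1, 0) 1
  have h := hf _ hσ (Pi.single i v)
  simp only [inv_one, rotate_one] at h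
  have h1 := congrFun (f.injective h) i
  rw [Pi.single_eq_same, Pi.single_eq_of_ne hi] at h1
  exact one_ne_zero (Finsupp.single_eq_zero.1 h1.symm)

end LinearOperation

/-! ### Existence of fixed operations -/

theorem continuous_comp_of_isClosed_fiber {X Y Z : Type*} [TopologicalSpace X] [TopologicalSpace Z]
    [Finite Y] {f : X → Y} (hf : ∀ y, IsClosed {x | f x = y}) (g : Y → Z) :
    Continuous fun x => g (f x) := by
  refine continuous_iff_isClosed.2 fun s _ => ?_
  have h : (fun x => g (f x)) ⁻¹' s = ⋃ y ∈ g ⁻¹' s, {x | f x = y} := by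
    ext x
    simp
  rw [h]
  exact (Set.toFinite _).isClosed_biUnion fun y _ => hf y

theorem AddChar.sum_circle_apply {Q : Type*} [AddCommGroup Q] [Finite Q]
    [Fintype (AddChar Q Circle)] (a : Q) (ha : a ≠ 0) : ∑ α : AddChar Q Circle, (α a : ℂ) = 0 := by
  classical
  cases nonempty_fintype Q
  have h := AddChar.sum_apply_eq_ite a
  rw [if_neg ha] at h
  rw [← h]
  exact Fintype.sum_equiv AddChar.circleEquivComplex.toEquiv _ _ fun _ => rfl

section Fourier

variable {Q : Type*} [CommGroup Q] [Fintype Q] {I : Type*} [MulAction Q I]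
  {E : Type*} [AddCommGroup E] [Module ℂ E]

/-- The component of `y : I → E` at `α`, along the orbit of `i`. -/
noncomputable def orbitTransform (α : AddChar (Additive Q) Circle) (i : I) : (I → E) →ₗ[ℂ] E :=
  ∑ q : Q, (α (Additive.ofMul q⁻¹) : ℂ) • LinearMap.proj (q • i)

theorem orbitTransform_apply (α : AddChar (Additive Q) Circle) (i : I) (y : I → E) :
    orbitTransform α i y = ∑ q : Q, (α (Additive.ofMul q⁻¹) : ℂ) • y (q • i) := by
  simp [orbitTransform]

theorem orbitTransform_smul (α : AddChar (Additive Q) Circle) (i : I) (y : I → E) (p : Q) :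
    orbitTransform α i (fun j => y (p • j)) =
      (α (Additive.ofMul p) : ℂ) • orbitTransform α i y := by
  rw [orbitTransform_apply, orbitTransform_apply, Finset.smul_sum]
  refine Fintype.sum_equiv (Equiv.mulLeft p) _ _ fun q => ?_
  have h : Additive.ofMul q⁻¹ = Additive.ofMul p + Additive.ofMul (p * q)⁻¹ := by
    rw [← ofMul_mul, mul_inv_rev, mul_comm q⁻¹, mul_inv_cancel_left]
  rw [Equiv.coe_mulLeft, h, AddChar.map_add_eq_mul, Circle.coe_mul, mul_smul, mul_smul]

/-- Fourier inversion: a family is determined by its transforms. -/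
theorem eq_zero_of_orbitTransform [Module.IsTorsionFree ℂ E] {y : I → E}
    (h : ∀ (α : AddChar (Additive Q) Circle) i, orbitTransform α i y = 0) : y = 0 := by
  classical
  have : Finite (AddChar (Additive Q) Circle) :=
    Finite.of_equiv _ AddChar.circleEquivComplex.toEquiv.symm
  cases nonempty_fintype (AddChar (Additive Q) Circle)
  ext1 i
  have h1 : ∑ α : AddChar (Additive Q) Circle, orbitTransform α i y =
      (Fintype.card (AddChar (Additive Q) Circle) : ℂ) • y i := by
    simp only [orbitTransform_apply]
    rw [Finset.sum_comm]
    simp only [← Finset.sum_smul]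
    rw [Finset.sum_eq_single 1]
    · simp
    · intro q _ hq
      rw [AddChar.sum_circle_apply _ fun h0 => hq (inv_eq_one.1 (ofMul_eq_zero.1 h0)), zero_smul]
    · exact fun h => absurd (Finset.mem_univ _) h
  rw [Finset.sum_eq_zero fun α _ => h α i] at h1
  exact (smul_eq_zero.1 h1.symm).resolve_left (Nat.cast_ne_zero.2 Fintype.card_ne_zero)

end Fourier

section Fixed

variable {G : Type u} [Group G]

/-- A subgroup `Γ` of `G × Σ_I` with `Γ ∩ Σ_I = 1` is the graph of a homomorphism from a subgroup
of `G`. -/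
theorem exists_graph {I : Type} (Γ : Subgroup (G × Equiv.Perm I))
    (h1 : ∀ σ, ((1 : G), σ) ∈ Γ → σ = 1) :
    ∃ (H : Subgroup G) (φ : H →* Equiv.Perm I), ∀ g σ, (g, σ) ∈ Γ ↔ ∃ h : g ∈ H, φ ⟨g, h⟩ = σ := by
  let π : Γ →* G := (MonoidHom.fst G (Equiv.Perm I)).comp Γ.subtype
  have hπ : Function.Injective π := by
    refine (injective_iff_map_eq_one π).2 ?_
    rintro ⟨⟨g, σ⟩, hγ⟩ h
    obtain rfl : g = 1 := h
    obtain rfl := h1 σ hγ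
    rfl
  let e := MonoidHom.ofInjective hπ
  refine ⟨π.range, ((MonoidHom.snd G (Equiv.Perm I)).comp Γ.subtype).comp e.symm.toMonoidHom,
    fun g σ => ⟨fun h => ⟨⟨⟨_, h⟩, rfl⟩, ?_⟩, ?_⟩⟩
  · have : e.symm ⟨g, ⟨⟨_, h⟩, rfl⟩⟩ = ⟨(g, σ), h⟩ := e.symm_apply_apply ⟨(g, σ), h⟩
    change (e.symm ⟨g, _⟩).1.2 = σ
    rw [this]
  · rintro ⟨⟨⟨⟨g', σ'⟩, hγ⟩, hg⟩, rfl⟩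
    obtain rfl : g' = g := hg
    have : e.symm ⟨g', ⟨⟨_, hγ⟩, rfl⟩⟩ = ⟨(g', σ'), hγ⟩ := e.symm_apply_apply ⟨(g', σ'), hγ⟩
    change (g', (e.symm ⟨g', _⟩).1.2) ∈ Γ
    rw [this]
    exact hγ

variable [TopologicalSpace G] [IsTorus G] {K : Subgroup G}

open LinearOperation in
/-- Fixed operations exist for the graph of `φ : H → Σ_I`. The isotypical components of a family
of vectors under the finite abelian group `φ(H)` are embedded equivariantly into the universe by
twisting characters; a numbering of all components makes their images independent. -/
theorem exists_isFixed (hK : IsConnected (K : Set G)) {I : Type} [Finite I]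
    (Γ : Subgroup (G × Equiv.Perm I)) (hΓ : ∀ σ, IsClosed {g : G | (g, σ) ∈ Γ})
    (h1 : ∀ σ, ((1 : G), σ) ∈ Γ → σ = 1) :
    ∃ f : LinearOperation (freeIndex K) I, IsFixed Γ f := by
  classical
  obtain ⟨H, φ, hφ⟩ := exists_graph Γ h1
  have hH : IsClosed (H : Set G) := by
    have : (H : Set G) = ⋃ σ, {g : G | (g, σ) ∈ Γ} := by
      ext g
      simp [hφ]
    rw [this]
    exact isClosed_iUnion_of_finite hΓ
  let Q := φ.range
  let _ : CommGroup Q :=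
    { (inferInstance : Group Q) with
      mul_comm := by
        rintro ⟨_, a, rfl⟩ ⟨_, b, rfl⟩
        refine Subtype.ext ?_
        change φ a * φ b = φ b * φ a
        rw [← map_mul, ← map_mul, show a * b = b * a from Subtype.ext (IsTorus.mul_comm _ _)] }
  cases nonempty_fintype Q
  have hfiber (q : Q) : IsClosed {h : H | φ.rangeRestrict h = q} := by
    have : {h : H | φ.rangeRestrict h = q} =
        Subtype.val ⁻¹' {g : G | (g, (q : Equiv.Perm I)) ∈ Γ} := by
      ext h
      simp [hφ, Subtype.ext_iff]
    rw [this]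
    exact (hΓ q).preimage continuous_subtype_val
  -- The transform at `α` is equivariant up to `α ∘ φ`, which the twist by its inverse `ψ α` cancels.
  let ψ (α : AddChar (Additive Q) Circle) : H →ₜ* Circle :=
    { toFun := fun h => (α (Additive.ofMul (φ.rangeRestrict h)))⁻¹
      map_one' := by rw [map_one, ofMul_one, AddChar.map_zero_eq_one, inv_one]
      map_mul' := fun a b => by
        rw [map_mul, ofMul_mul, AddChar.map_add_eq_mul, mul_inv]
      continuous_toFun := continuous_comp_of_isClosed_fiber hfiber
        fun q => (α (Additive.ofMul q))⁻¹ }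
  have hψ (α) : (Set.range (ψ α)).Finite := by
    refine (Set.finite_range fun q : Q => (α (Additive.ofMul q))⁻¹).subset ?_
    rintro _ ⟨h, rfl⟩
    exact ⟨_, rfl⟩
  choose m b hm hmb hmK using fun α => exists_character_twist hK hH (ψ α) (hψ α)
  have : Finite (AddChar (Additive Q) Circle) :=
    Finite.of_equiv _ AddChar.circleEquivComplex.toEquiv.symm
  cases nonempty_fintype (AddChar (Additive Q) Circle)
  cases nonempty_fintype I
  let ι := AddChar (Additive Q) Circle × I
  -- The numbering records the component and the Boolean that makes the twist injective, so that the
  -- maps `μ l` of the indices are injective with disjoint images.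
  obtain ⟨code, hcode⟩ := exists_injective_nat (ι × Bool × ℕ)
  let μ (l : ι) (a : CharIndex G) : CharIndex G := (m l.1 a.1, code (l, b l.1 a.1, a.2))
  have hμ (l l' : ι) (a a' : CharIndex G) (h : μ l a = μ l' a') : l = l' ∧ a = a' := by
    simp only [μ, Prod.mk.injEq] at h
    obtain ⟨hχ, hc⟩ := h
    have h2 := hcode hc
    clear hc
    simp only [Prod.mk.injEq] at h2
    obtain ⟨rfl, hb, hn⟩ := h2
    exact ⟨rfl, Prod.ext (hmb _ _ _ hχ hb) hn⟩
  let F (l : ι) : (I → CharIndex G →₀ ℂ) →ₗ[ℂ] (CharIndex G →₀ ℂ) := orbitTransform (Q := Q) l.1 l.2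
  refine ⟨⟨∑ l, reindex (μ l) ∘ₗ F l, ?_, ?_⟩, ?_⟩
  · refine (injective_iff_map_eq_zero _).2 fun y hy => ?_
    refine eq_zero_of_orbitTransform (Q := Q) fun α i => ?_
    ext a
    have h := DFunLike.congr_fun hy (μ (α, i) a)
    simp only [LinearMap.coe_sum, Finset.sum_apply, LinearMap.comp_apply,
      Finsupp.finsetSum_apply] at h
    rw [Finset.sum_eq_single (α, i), reindex_apply fun a a' h => (hμ _ _ _ _ h).2] at h
    · exact h
    · intro l _ hl
      refine reindex_of_notMem_range _ ?_
      rintro ⟨a', ha'⟩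
      exact hl (hμ _ _ _ _ ha').1
    · exact fun h => absurd (Finset.mem_univ _) h
  · intro y hy
    simp only [LinearMap.coe_sum, Finset.sum_apply, LinearMap.comp_apply]
    refine Submodule.sum_mem _ fun l _ => reindex_mem_supported (fun a ha => hmK _ _ ha) ?_
    simp only [F, orbitTransform_apply]
    exact Submodule.sum_mem _ fun q _ => Submodule.smul_mem _ _ (hy _)
  · rintro ⟨g, σ⟩ hγ y
    obtain ⟨hg, rfl⟩ := (hφ g σ).1 hγ
    simp only [LinearMap.coe_sum, Finset.sum_apply, LinearMap.comp_apply, map_sum]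
    refine Finset.sum_congr rfl fun l _ => ?_
    let p : Q := φ.rangeRestrict ⟨g, hg⟩
    have hF : F l (fun i => rotate g⁻¹ (y (φ ⟨g, hg⟩ i))) =
        (l.1 (Additive.ofMul p) : ℂ) • rotate g⁻¹ (F l y) := by
      rw [← _root_.map_smul, ← orbitTransform_smul, orbitTransform_apply]
      simp only [orbitTransform_apply, map_sum, _root_.map_smul]
      rfl
    rw [hF, _root_.map_smul, _root_.map_smul,
      rotate_reindex (c := ((l.1 (Additive.ofMul p))⁻¹ : Circle)), rotate_rotate_inv, smul_smul,
      ← Circle.coe_mul, mul_inv_cancel, Circle.coe_one, one_smul]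
    intro a
    rw [← Circle.coe_mul, mul_comm]
    exact congrArg _ (hm l.1 a.1 ⟨g, hg⟩)

/-- The operad of linear operations is an `E_∞^G`-operad. -/
theorem linearOperad_isEInftyG (hK : IsConnected (K : Set G)) :
    (linearOperad G (freeIndex K)).IsEInftyG := by
  intro n Γ hΓ
  have h : (linearOperad G (freeIndex K)).fixed n Γ =
      {f : LinearOperation (freeIndex K) (Fin n) | LinearOperation.IsFixed Γ f} :=
    Set.ext fun f => LinearOperation.isFixed_iff.symm
  refine ⟨fun h1 => ?_, ?_⟩
  · obtain ⟨f, hf⟩ := exists_isFixed hK Γ hΓ h1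
    rw [h]
    exact LinearOperation.contractibleSpace_isFixed hf
  · rintro ⟨σ, hσ, hσ1⟩
    rw [h]
    exact Set.eq_empty_of_forall_notMem fun f => LinearOperation.not_isFixed hσ hσ1 f

end Fixed

/-! ### Coordinate subspaces and fixed-free subrepresentations -/

section Coordinates

variable {G : Type u} [Group G] [TopologicalSpace G] {K : Subgroup G}

/-- A vector of the complete universe as a finitely supported function. -/
noncomputable def toFinsupp (v : completeUniverse G) : CharIndex G →₀ ℂ :=
  Finsupp.ofSupportFinite v.1 v.2

/-- A finitely supported function as a vector of the complete universe. -/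
def ofFinsupp (u : CharIndex G →₀ ℂ) : completeUniverse G := ⟨u, u.hasFiniteSupport⟩

@[simp]
theorem toFinsupp_ofFinsupp (u : CharIndex G →₀ ℂ) : toFinsupp (ofFinsupp u) = u := by
  ext a; rfl

theorem universeRep_apply (g : G) (v : completeUniverse G) (a : CharIndex G) :
    (universeRep G g v).1 a = (a.1 g : ℂ) * v.1 a := rfl

/-- The vectors supported in a finite set of coordinates. -/
def coordinateSubspace (S : Finset (CharIndex G)) : Submodule ℝ (completeUniverse G) where
  carrier := {v | ∀ a ∉ S, v.1 a = 0}
  zero_mem' _ _ := rfl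
  add_mem' hv hw a ha := by
    change _ + _ = (0 : ℂ)
    rw [hv a ha, hw a ha, add_zero]
  smul_mem' c v hv a ha := by
    change c • v.1 a = 0
    rw [hv a ha, smul_zero]

theorem isFixedFree_coordinateSubspace {S : Finset (CharIndex G)}
    (hS : ∀ a ∈ S, a ∈ freeIndex K) : IsFixedFree K (coordinateSubspace S) where
  finiteDimensional := by
    let L : coordinateSubspace S →ₗ[ℝ] (S → ℂ) :=
      { toFun := fun v a => v.1.1 a
        map_add' := fun _ _ => rfl
        map_smul' := fun _ _ => rfl }
    refine FiniteDimensional.of_injective L fun v w h => ?_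
    refine Subtype.ext (Subtype.ext (funext fun a => ?_))
    by_cases ha : a ∈ S
    · exact congrFun h ⟨a, ha⟩
    · rw [v.2 a ha, w.2 a ha]
  invariant g v hv a ha := by
    rw [universeRep_apply, hv a ha, mul_zero]
  fixed_eq_zero v hv hfix := by
    refine Subtype.ext (funext fun a => ?_)
    by_cases ha : a ∈ S
    · obtain ⟨k, hk, hka⟩ := hS a ha
      have h : (a.1 k : ℂ) * v.1 a = v.1 a := congrFun (congrArg Subtype.val (hfix k hk)) a
      have h1 : ((a.1 k : ℂ) - 1) * v.1 a = 0 := by rw [sub_mul, h, one_mul, sub_self]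
      exact (mul_eq_zero.1 h1).resolve_left (sub_ne_zero.2 fun h => hka (Circle.ext h))
    · exact hv a ha

theorem Circle.re_ne_one {z : Circle} (hz : z ≠ 1) : (z : ℂ).re ≠ 1 := by
  intro h
  have h1 := Circle.normSq_coe z
  rw [Complex.normSq_apply, h] at h1
  refine hz (Circle.ext (Complex.ext h ?_))
  rw [Circle.coe_one, Complex.one_im]
  nlinarith

/-- A vector of a subrepresentation without `K`-fixed vectors has no coordinates on which `K` acts
trivially. For `k ∈ K`, the real operator `k + k⁻¹ - 2 Re χ(k)` kills the coordinates of
character `χ`, and multiplies those on which `K` acts trivially by `2 - 2 Re χ(k)`. Such operators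
would produce a nonzero fixed vector. -/
theorem IsFixedFree.mem_freeIndex {V : Submodule ℝ (completeUniverse G)} (hV : IsFixedFree K V)
    {v : completeUniverse G} (hv : v ∈ V) {a : CharIndex G} (ha : v.1 a ≠ 0) :
    a ∈ freeIndex K := by
  classical
  by_contra hfree
  have hone : ∀ k ∈ K, a.1 k = 1 := by
    intro k hk
    by_contra h
    exact hfree ⟨k, hk, h⟩
  have hkill (S : Finset (CharIndex G)) (hS : ∀ b ∈ S, b ∈ freeIndex K) :
      ∃ w ∈ V, w.1 a ≠ 0 ∧ (∀ b ∈ S, w.1 b = 0) ∧ ∀ b, v.1 b = 0 → w.1 b = 0 := by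
    induction S using Finset.induction_on with
    | empty => exact ⟨v, hv, ha, by simp, fun _ h => h⟩
    | insert b S _ ih =>
      obtain ⟨w, hw, hwa, hwS, hwv⟩ := ih fun c hc => hS c (Finset.mem_insert_of_mem hc)
      obtain ⟨k, hk, hkb⟩ := hS b (Finset.mem_insert_self b S)
      -- The operator `k + k⁻¹ - 2 Re χ(k)` for the character `χ` of `b`.
      let w' := universeRep G k w + universeRep G k⁻¹ w + (-(2 * (b.1 k : ℂ).re) : ℝ) • w
      have hw' (c : CharIndex G) :
          w'.1 c = ((2 * (c.1 k : ℂ).re - 2 * (b.1 k : ℂ).re : ℝ) : ℂ) * w.1 c := by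
        change (c.1 k : ℂ) * w.1 c + (c.1 k⁻¹ : ℂ) * w.1 c +
          (-(2 * (b.1 k : ℂ).re) : ℝ) • w.1 c = _
        rw [map_inv, Circle.coe_inv_eq_conj, ← add_mul, Complex.add_conj, Complex.real_smul,
          ← add_mul]
        push_cast
        ring
      refine ⟨w', add_mem (add_mem (hV.invariant k w hw) (hV.invariant k⁻¹ w hw))
        (V.smul_mem _ hw), ?_, ?_, ?_⟩
      · rw [hw', hone k hk]
        refine mul_ne_zero (Complex.ofReal_ne_zero.2 ?_) hwa
        have := Circle.re_ne_one hkb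
        rw [Circle.coe_one, Complex.one_re, ← mul_sub]
        exact mul_ne_zero two_ne_zero (sub_ne_zero.2 this.symm)
      · intro c hc
        rw [hw']
        rcases Finset.mem_insert.1 hc with rfl | hc
        · rw [sub_self, Complex.ofReal_zero, zero_mul]
        · rw [hwS c hc, mul_zero]
      · intro c hc
        rw [hw', hwv c hc, mul_zero]
  obtain ⟨w, hw, hwa, hw0, hwv⟩ :=
    hkill ((toFinsupp v).support.filter (· ∈ freeIndex K)) (by simp)
  have hfix : w = 0 := by
    refine hV.fixed_eq_zero w hw fun k hk => Subtype.ext (funext fun b => ?_)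
    change (b.1 k : ℂ) * w.1 b = w.1 b
    by_cases hb : w.1 b = 0
    · rw [hb, mul_zero]
    · have hb' : b ∉ freeIndex K := fun h => hb (hw0 b (by
        rw [Finset.mem_filter, Finsupp.mem_support_iff]
        exact ⟨fun h => hb (hwv b h), h⟩))
      have : b.1 k = 1 := by
        by_contra h
        exact hb' ⟨k, hk, h⟩
      rw [this, Circle.coe_one, one_mul]
  rw [hfix] at hwa
  exact hwa rfl

theorem IsFixedFree.exists_support {V : Submodule ℝ (completeUniverse G)} (hV : IsFixedFree K V) :
    ∃ S : Finset (CharIndex G), ∀ v ∈ V, (toFinsupp v).support ⊆ S := by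
  classical
  obtain ⟨B, hB⟩ : V.FG := (Submodule.fg_top V).1 hV.finiteDimensional.1
  refine ⟨B.biUnion fun v => (toFinsupp v).support, fun v hv => ?_⟩
  have h : V ≤ coordinateSubspace (B.biUnion fun v => (toFinsupp v).support) := by
    rw [← hB, Submodule.span_le]
    intro w hw a ha
    by_contra h
    exact ha (Finset.mem_biUnion.2 ⟨w, hw, Finsupp.mem_support_iff.2 h⟩)
  intro a ha
  by_contra h'
  exact Finsupp.mem_support_iff.1 ha (h hv a h')

end Coordinates

/-! ### The points of `S^{∞V(K)}` -/

namespace SInfty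

variable {G : Type u} [Group G] [TopologicalSpace G] {K : Subgroup G}

/-- The vector of a point of `S^{∞V(K)}`. The point at infinity has the junk value `0`. -/
noncomputable def vec (x : SInfty K) : CharIndex G →₀ ℂ := x.1.elim 0 toFinsupp

/-- The point at infinity. -/
noncomputable def infPt (K : Subgroup G) : SInfty K := incl ⟨⊥, isFixedFree_bot K⟩ ∞

/-- The point of a vector supported in the coordinates on which `K` acts nontrivially. -/
noncomputable def finPt (u : CharIndex G →₀ ℂ) (hu : u ∈ Finsupp.supported ℂ ℂ (freeIndex K)) :
    SInfty K :=
  ⟨(ofFinsupp u : OnePoint (completeUniverse G)), coordinateSubspace u.support,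
    isFixedFree_coordinateSubspace fun _ ha => hu ha,
    ((⟨ofFinsupp u, fun _ ha => Finsupp.notMem_support_iff.1 ha⟩ :
      coordinateSubspace u.support) : OnePoint (coordinateSubspace u.support)), rfl⟩

theorem vec_mem_supported (x : SInfty K) : vec x ∈ Finsupp.supported ℂ ℂ (freeIndex K) := by
  obtain ⟨_, V, hV, y, rfl⟩ := x
  cases y with
  | infty => exact Submodule.zero_mem _
  | coe v => exact fun a ha => hV.mem_freeIndex v.2 (Finsupp.mem_support_iff.1 ha)

theorem eq_infPt_or (x : SInfty K) : x = infPt K ∨ x = finPt (vec x) (vec_mem_supported x) := by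
  obtain ⟨_, V, hV, y, rfl⟩ := x
  cases y with
  | infty => exact Or.inl rfl
  | coe v => exact Or.inr rfl

theorem finPt_vec {x : SInfty K} (hx : x ≠ infPt K) : finPt (vec x) (vec_mem_supported x) = x :=
  ((eq_infPt_or x).resolve_left hx).symm

@[simp]
theorem vec_finPt (u : CharIndex G →₀ ℂ) (hu : u ∈ Finsupp.supported ℂ ℂ (freeIndex K)) :
    vec (finPt u hu) = u := toFinsupp_ofFinsupp u

theorem finPt_ne_infPt (u : CharIndex G →₀ ℂ) (hu : u ∈ Finsupp.supported ℂ ℂ (freeIndex K)) :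
    finPt u hu ≠ infPt K := fun h => OnePoint.coe_ne_infty _ (congrArg Subtype.val h)

theorem finPt_congr {u u' : CharIndex G →₀ ℂ} (h : u = u')
    {hu : u ∈ Finsupp.supported ℂ ℂ (freeIndex K)}
    {hu' : u' ∈ Finsupp.supported ℂ ℂ (freeIndex K)} :
    finPt u hu = finPt u' hu' := by
  subst h; rfl

theorem smul_infPt (g : G) : g • infPt K = infPt K := rfl

theorem smul_eq_infPt_iff (g : G) (x : SInfty K) : g • x = infPt K ↔ x = infPt K :=
  ⟨fun h => by rw [← inv_smul_smul g x, h, smul_infPt], fun h => by rw [h, smul_infPt]⟩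

theorem vec_smul (g : G) (x : SInfty K) : vec (g • x) = rotate g (vec x) := by
  obtain ⟨_, V, hV, y, rfl⟩ := x
  cases y with
  | infty => exact (map_zero (rotate g)).symm
  | coe v => ext a; rfl

theorem smul_finPt (g : G) (u : CharIndex G →₀ ℂ)
    (hu : u ∈ Finsupp.supported ℂ ℂ (freeIndex K)) :
    g • finPt u hu = finPt (rotate g u) (rotate_mem_supported g hu) := by
  have h : g • finPt u hu ≠ infPt K := by
    rw [Ne, smul_eq_infPt_iff]
    exact finPt_ne_infPt u hu
  rw [← finPt_vec h]
  exact finPt_congr (by rw [vec_smul, vec_finPt])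

/-- The operation of a linear operation on `S^{∞V(K)}`: it is the linear map on the smash power of
the spheres. -/
noncomputable def act {I : Type} (f : LinearOperation (freeIndex K) I) (y : I → SInfty K) :
    SInfty K :=
  open Classical in
  if ∃ i, y i = infPt K then infPt K
  else finPt (f.toLinearMap fun i => vec (y i)) (f.supported _ fun i => vec_mem_supported (y i))

theorem act_of_infPt {I : Type} (f : LinearOperation (freeIndex K) I) {y : I → SInfty K}
    (h : ∃ i, y i = infPt K) : act f y = infPt K := if_pos h

theorem act_of_ne {I : Type} (f : LinearOperation (freeIndex K) I) {y : I → SInfty K}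
    (h : ¬ ∃ i, y i = infPt K) : act f y = finPt (f.toLinearMap fun i => vec (y i))
      (f.supported _ fun i => vec_mem_supported (y i)) := if_neg h

theorem act_eq_infPt_iff {I : Type} (f : LinearOperation (freeIndex K) I) {y : I → SInfty K} :
    act f y = infPt K ↔ ∃ i, y i = infPt K := by
  refine ⟨fun h => ?_, act_of_infPt f⟩
  by_contra h'
  rw [act_of_ne f h'] at h
  exact finPt_ne_infPt _ _ h

theorem act_smul {I : Type} (g : G) (f : LinearOperation (freeIndex K) I) (y : I → SInfty K) :
    act (g • f) (fun i => g • y i) = g • act f y := by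
  by_cases h : ∃ i, y i = infPt K
  · rw [act_of_infPt f h, act_of_infPt, smul_infPt]
    simpa only [smul_eq_infPt_iff] using h
  · rw [act_of_ne f h, act_of_ne, smul_finPt]
    · refine finPt_congr ?_
      simp only [LinearOperation.smul_apply, vec_smul, rotate_inv_rotate]
    · simpa only [smul_eq_infPt_iff] using h

theorem act_relabel {I J : Type} (e : I ≃ J) (f : LinearOperation (freeIndex K) I)
    (y : J → SInfty K) : act (f.relabel e) y = act f fun i => y (e i) := by
  by_cases h : ∃ j, y j = infPt K
  · rw [act_of_infPt _ h, act_of_infPt]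
    obtain ⟨j, hj⟩ := h
    exact ⟨e.symm j, by rwa [e.apply_symm_apply]⟩
  · rw [act_of_ne _ h, act_of_ne]
    · rfl
    · exact fun ⟨i, hi⟩ => h ⟨e i, hi⟩

theorem act_one (y : Unit → SInfty K) : act (.one (freeIndex K)) y = y () := by
  by_cases h : y () = infPt K
  · rw [act_of_infPt _ ⟨(), h⟩, h]
  · rw [act_of_ne _ fun ⟨_, hi⟩ => h hi]
    exact finPt_vec h

theorem act_comp {I : Type} {J : I → Type} (f : LinearOperation (freeIndex K) I)
    (g : ∀ i, LinearOperation (freeIndex K) (J i)) (y : (Σ i, J i) → SInfty K) :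
    act (f.comp g) y = act f fun i => act (g i) fun j => y ⟨i, j⟩ := by
  by_cases h : ∃ p, y p = infPt K
  · obtain ⟨⟨i, j⟩, hij⟩ := h
    rw [act_of_infPt _ ⟨⟨i, j⟩, hij⟩, act_of_infPt _ ⟨i, act_of_infPt _ ⟨j, hij⟩⟩]
  · have h' (i : I) : ¬ ∃ j, y ⟨i, j⟩ = infPt K := fun ⟨j, hj⟩ => h ⟨⟨i, j⟩, hj⟩
    have h'' : ¬ ∃ i, act (g i) (fun j => y ⟨i, j⟩) = infPt K := fun ⟨i, hi⟩ =>
      h' i ((act_eq_infPt_iff _).1 hi)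
    rw [act_of_ne _ h, act_of_ne _ h'']
    refine finPt_congr ?_
    simp only [act_of_ne _ (h' _), vec_finPt]
    rfl

end SInfty

/-! ### Continuity of the action -/

namespace SInfty

variable {G : Type u} [Group G] [TopologicalSpace G] {K : Subgroup G}

theorem incl_injective (V : {V : Submodule ℝ (completeUniverse G) // IsFixedFree K V}) :
    Function.Injective (incl V) := by
  intro x y h
  exact Option.map_injective Subtype.val_injective (congrArg Subtype.val h)

theorem isClosedEmbedding_incl (V : {V : Submodule ℝ (completeUniverse G) // IsFixedFree K V}) :
    IsClosedEmbedding (incl V) :=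
  (continuous_incl V).isClosedEmbedding (incl_injective V)

/-- A compact family of points of `S^{∞V(K)}` lies in one sphere. -/
theorem exists_finset_vec_support {T : Type*} [TopologicalSpace T] [CompactSpace T]
    {y : T → SInfty K} (hy : Continuous y) :
    ∃ S : Finset (CharIndex G), ∀ t, (vec (y t)).support ⊆ S := by
  refine exists_finset_support_subset hy vec fun E hE => ?_
  refine isOpen_compl_iff.1 (isOpen_iff.2 fun V => ?_)
  obtain ⟨S, hS⟩ := V.2.exists_support
  have h : incl V ⁻¹' Eᶜ = (incl V ⁻¹' {x ∈ E | (vec x).support ⊆ S})ᶜ := by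
    ext z
    have : (vec (incl V z)).support ⊆ S := by
      cases z with
      | infty => exact Finset.empty_subset S
      | coe v => exact hS v v.2
    simp [this]
  rw [h]
  exact ((hE S).isClosed.preimage (continuous_incl V)).isOpen_compl

section Sphere

variable (S : Finset (CharIndex G))

/-- The coordinates of a point of the sphere `S^{ℂ^S}`. The point at infinity has the junk value
`0`. -/
noncomputable def coords (z : OnePoint (coordinateSubspace S)) : S → ℂ :=
  z.elim 0 fun v a => v.1.1 a

/-- The inclusion of `ℂ^S`. -/
noncomputable def extend (w : S → ℂ) : CharIndex G →₀ ℂ :=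
  ∑ a : S, Finsupp.single (a : CharIndex G) (w a)

variable {S}

theorem extend_smul (c : ℂ) (w : S → ℂ) : extend S (c • w) = c • extend S w := by
  simp [extend, Finset.smul_sum]

theorem extend_apply (w : S → ℂ) (a : S) : extend S w a = w a := by
  classical
  simp only [extend, Finsupp.finsetSum_apply, Finsupp.single_apply]
  rw [Finset.sum_eq_single a]
  · simp
  · intro b _ hb
    rw [if_neg fun h => hb (Subtype.ext h)]
  · exact fun h => absurd (Finset.mem_univ _) h

theorem extend_apply_of_notMem (w : S → ℂ) {a : CharIndex G} (ha : a ∉ S) : extend S w a = 0 := by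
  classical
  simp only [extend, Finsupp.finsetSum_apply, Finsupp.single_apply]
  refine Finset.sum_eq_zero fun b _ => if_neg ?_
  rintro rfl
  exact ha b.2

theorem isFiniteFamily_extend {T : Type*} [TopologicalSpace T] {w : T → S → ℂ}
    (hw : Continuous w) : IsFiniteFamily fun t => extend S (w t) := by
  refine ⟨⟨S, fun t a ha => ?_⟩, fun a => ?_⟩
  · by_contra h
    exact Finsupp.mem_support_iff.1 ha (extend_apply_of_notMem _ h)
  · by_cases ha : a ∈ S
    · simp only [fun t => extend_apply (w t) ⟨a, ha⟩]
      exact (continuous_apply _).comp hw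
    · simp only [fun t => extend_apply_of_notMem (w t) ha]
      exact continuous_const

theorem extend_coords (hS : ∀ a ∈ S, a ∈ freeIndex K) (z : OnePoint (coordinateSubspace S)) :
    extend S (coords S z) =
      vec (incl (K := K) ⟨coordinateSubspace S, isFixedFree_coordinateSubspace hS⟩ z) := by
  ext a
  by_cases ha : a ∈ S
  · rw [extend_apply _ ⟨a, ha⟩]
    cases z <;> rfl
  · rw [extend_apply_of_notMem _ ha]
    cases z with
    | infty => rfl
    | coe v => exact (v.2 a ha).symm

theorem continuousAt_coords {z : OnePoint (coordinateSubspace S)} (hz : z ≠ ∞) :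
    ContinuousAt (coords S) z := by
  obtain ⟨v, rfl⟩ := OnePoint.ne_infty_iff_exists.1 hz
  rw [OnePoint.continuousAt_coe]
  refine Continuous.continuousAt (continuous_pi fun a => ?_)
  exact (continuous_apply (a : CharIndex G)).comp
    (continuous_subtype_val.comp continuous_subtype_val)

/-- Near infinity, the coordinates are large. -/
theorem eventually_lt_norm_coords (hS : ∀ a ∈ S, a ∈ freeIndex K) (C : ℝ) :
    ∀ᶠ z in 𝓝 (∞ : OnePoint (coordinateSubspace S)), z ≠ ∞ → C < ‖coords S z‖ := by
  have hV := (isFixedFree_coordinateSubspace hS).finiteDimensional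
  have hc := isCompact_box hV (max C 0)
  refine Filter.mem_of_superset ((OnePoint.isOpen_compl_image_coe.2 ⟨hc.isClosed, hc⟩).mem_nhds
    OnePoint.infty_notMem_image_coe) fun z hz hz' => ?_
  obtain ⟨v, rfl⟩ := OnePoint.ne_infty_iff_exists.1 hz'
  by_contra! hle
  refine hz ⟨v, fun a => ?_, rfl⟩
  by_cases ha : a ∈ S
  · exact (norm_le_pi_norm (coords S (v : OnePoint (coordinateSubspace S))) ⟨a, ha⟩).trans
      (hle.trans (le_max_left _ _))
  · rw [v.2 a ha, norm_zero]
    exact le_max_right _ _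

end Sphere

/-- A compact family of injective operations is uniformly bounded below on `(ℂ^S)^I`. -/
theorem exists_lower_bound {T : Type*} [TopologicalSpace T] [CompactSpace T] {I : Type} [Fintype I]
    {f : T → LinearOperation (freeIndex K) I} (hf : LinearOperation.IsFamily f)
    (S S' : Finset (CharIndex G))
    (hS' : ∀ t (w : I → S → ℂ), ((f t).toLinearMap fun i => extend S (w i)).support ⊆ S') :
    ∃ c > 0, ∀ t (w : I → S → ℂ),
      c * ‖w‖ ≤ ∑ a ∈ S', ‖(f t).toLinearMap (fun i => extend S (w i)) a‖ := by
  let N (q : T × (I → S → ℂ)) : ℝ :=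
    ∑ a ∈ S', ‖(f q.1).toLinearMap (fun i => extend S (q.2 i)) a‖
  have hN : Continuous N := by
    refine continuous_finsetSum _ fun a _ => Continuous.norm ?_
    refine (IsFiniteFamily.apply_pi (p := fun q : T × (I → S → ℂ) => (f q.1).toLinearMap)
      (hf.comp continuous_fst) fun i => isFiniteFamily_extend ?_).2 a
    exact (continuous_apply i).comp continuous_snd
  have hpos : ∀ q ∈ (Set.univ : Set T) ×ˢ Metric.sphere (0 : I → S → ℂ) 1, 0 < N q := by
    rintro ⟨t, w⟩ ⟨-, hw⟩
    refine lt_of_le_of_ne (Finset.sum_nonneg fun _ _ => norm_nonneg _) fun h => ?_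
    have h0 : (f t).toLinearMap (fun i => extend S (w i)) = 0 := by
      ext a
      by_cases ha : a ∈ S'
      · exact norm_eq_zero.1 ((Finset.sum_eq_zero_iff_of_nonneg fun _ _ => norm_nonneg _).1
          h.symm a ha)
      · exact Finsupp.notMem_support_iff.1 fun h => ha (hS' t w h)
    have h1 := (injective_iff_map_eq_zero _).1 (f t).injective _ h0
    have h2 : w = 0 := by
      ext i a
      rw [← extend_apply (w i) a, congrFun h1 i]
      rfl
    rw [h2] at hw
    simp at hw
  obtain ⟨c, hc, hcN⟩ := (isCompact_univ.prod (isCompact_sphere 0 1)).exists_forall_le'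
    hN.continuousOn hpos
  refine ⟨c, hc, fun t w => ?_⟩
  by_cases hw : w = 0
  · rw [hw, norm_zero, mul_zero]
    exact Finset.sum_nonneg fun _ _ => norm_nonneg _
  · have hw' : ‖w‖ ≠ 0 := norm_ne_zero_iff.2 hw
    have h1 := hcN (t, ((‖w‖⁻¹ : ℝ) : ℂ) • w) ⟨trivial, by
      rw [mem_sphere_zero_iff_norm, norm_smul, Complex.norm_real, norm_inv, norm_norm,
        inv_mul_cancel₀ hw']⟩
    have h2 : N (t, ((‖w‖⁻¹ : ℝ) : ℂ) • w) = ‖w‖⁻¹ * N (t, w) := by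
      simp only [N, Finset.mul_sum]
      refine Finset.sum_congr rfl fun a _ => ?_
      have h3 : (fun i => extend S ((((‖w‖⁻¹ : ℝ) : ℂ) • w) i)) =
          ((‖w‖⁻¹ : ℝ) : ℂ) • fun i => extend S (w i) :=
        funext fun i => extend_smul _ _
      rw [h3, _root_.map_smul, Finsupp.smul_apply, norm_smul, Complex.norm_real, norm_inv,
        norm_norm]
    rw [h2, inv_mul_eq_div, le_div_iff₀ (by positivity)] at h1
    exact h1

/-- The action is continuous on compact families: the points and their images lie in single spheres,
the operations restrict to a continuous family of injective linear maps between finite-dimensional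
spaces, and this family is uniformly proper. -/
theorem continuous_act {T : Type u} [TopologicalSpace T] [CompactSpace T] [T2Space T]
    {I : Type} [Finite I] {f : T → LinearOperation (freeIndex K) I}
    (hf : LinearOperation.IsFamily f) {y : T → I → SInfty K} (hy : ∀ i, Continuous fun t => y t i) :
    Continuous fun t => act (f t) (y t) := by
  classical
  cases nonempty_fintype I
  choose S₀ hS₀ using fun i => exists_finset_vec_support (hy i)
  -- All the points `y t i` lie in the sphere of `ℂ^S`, and all their images in the one of `ℂ^S'`.
  let S : Finset (CharIndex G) := (Finset.univ.biUnion S₀).filter (· ∈ freeIndex K)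
  have hS : ∀ a ∈ S, a ∈ freeIndex K := fun a ha => (Finset.mem_filter.1 ha).2
  let V : {V : Submodule ℝ (completeUniverse G) // IsFixedFree K V} :=
    ⟨coordinateSubspace S, isFixedFree_coordinateSubspace hS⟩
  have hyV (t : T) (i : I) : ∃ z, incl V z = y t i := by
    by_cases h : y t i = infPt K
    · exact ⟨∞, h.symm⟩
    · have hmem : ofFinsupp (vec (y t i)) ∈ V.1 := by
        intro a ha
        by_contra h0
        refine ha (Finset.mem_filter.2 ⟨Finset.mem_biUnion.2 ⟨i, Finset.mem_univ i,
          hS₀ i t (Finsupp.mem_support_iff.2 h0)⟩, ?_⟩)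
        exact vec_mem_supported (y t i) (Finsupp.mem_support_iff.2 h0)
      refine ⟨((⟨_, hmem⟩ : V.1) : OnePoint V.1), ?_⟩
      conv_rhs => rw [← finPt_vec h]
      rfl
  choose z hz using hyV
  have hzc (i : I) : Continuous fun t => z t i := by
    refine (isClosedEmbedding_incl V).isInducing.continuous_iff.2 ?_
    simpa only [Function.comp_def, hz] using hy i
  have hzinf (t : T) (i : I) : z t i = ∞ ↔ y t i = infPt K := by
    rw [← hz]
    exact (incl_injective V).eq_iff (b := ∞).symm
  have hvec (t : T) (i : I) : vec (y t i) = extend S (coords S (z t i)) := by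
    rw [← hz, extend_coords hS]
  have hfam : IsFiniteFamily fun q : T × (I → S → ℂ) =>
      (f q.1).toLinearMap fun i => extend S (q.2 i) :=
    IsFiniteFamily.apply_pi (p := fun q : T × (I → S → ℂ) => (f q.1).toLinearMap)
      (hf.comp continuous_fst) fun i => isFiniteFamily_extend
        ((continuous_apply i).comp continuous_snd)
  have hfree (t : T) (w : I → S → ℂ) : (f t).toLinearMap (fun i => extend S (w i)) ∈
      Finsupp.supported ℂ ℂ (freeIndex K) := by
    refine (f t).supported _ fun i a ha => hS a ?_
    by_contra h
    exact Finsupp.mem_support_iff.1 ha (extend_apply_of_notMem _ h)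
  obtain ⟨S₁, hS₁⟩ := hfam.1
  let S' : Finset (CharIndex G) := S₁.filter (· ∈ freeIndex K)
  have hS' (t : T) (w : I → S → ℂ) :
      ((f t).toLinearMap fun i => extend S (w i)).support ⊆ S' := fun a ha =>
    Finset.mem_filter.2 ⟨hS₁ (t, w) ha, hfree t w ha⟩
  let V' : {V : Submodule ℝ (completeUniverse G) // IsFixedFree K V} :=
    ⟨coordinateSubspace S', isFixedFree_coordinateSubspace fun a ha => (Finset.mem_filter.1 ha).2⟩
  let Z (t : T) : V'.1 := ⟨ofFinsupp ((f t).toLinearMap fun i => extend S (coords S (z t i))),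
    fun a ha => Finsupp.notMem_support_iff.1 fun h => ha (hS' t _ h)⟩
  let r (t : T) : OnePoint V'.1 := if ∃ i, z t i = ∞ then ∞ else (Z t : OnePoint V'.1)
  have hr (t : T) : incl V' (r t) = act (f t) (y t) := by
    by_cases h : ∃ i, z t i = ∞
    · rw [act_of_infPt _ (by simpa only [hzinf] using h), show r t = ∞ from if_pos h]
      rfl
    · rw [act_of_ne _ (by simpa only [hzinf] using h), show r t = Z t from if_neg h]
      simp only [hvec]
      rfl
  suffices h : Continuous r by
    simpa only [Function.comp_def, hr] using (continuous_incl V').comp h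
  refine continuous_iff_continuousAt.2 fun t₀ => ?_
  by_cases h₀ : ∃ i, z t₀ i = ∞
  · have hr₀ : r t₀ = ∞ := if_pos h₀
    obtain ⟨i₀, hi₀⟩ := h₀
    -- If one of the points is near infinity, then so is the image, by the uniform lower bound.
    obtain ⟨c, hc, hcN⟩ := exists_lower_bound hf S S' hS'
    rw [ContinuousAt, hr₀, OnePoint.hasBasis_nhds_infty.tendsto_right_iff]
    rintro C ⟨-, hC⟩
    have hNc : Continuous fun v : V'.1 => ∑ a ∈ S', ‖v.1.1 a‖ :=
      continuous_finsetSum _ fun a _ => ((continuous_apply a).comp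
        (continuous_subtype_val.comp continuous_subtype_val)).norm
    obtain ⟨R, hR⟩ := (hC.image hNc).bddAbove
    have hlim := (hzc i₀).tendsto t₀
    rw [hi₀] at hlim
    have hev := hlim.eventually (eventually_lt_norm_coords hS (R / c))
    filter_upwards [hev] with t ht
    by_cases h : ∃ i, z t i = ∞
    · exact Or.inr (if_pos h)
    · refine Or.inl ⟨Z t, fun hmem => ?_, (if_neg h).symm⟩
      have h1 := hR ⟨Z t, hmem, rfl⟩
      have h2 := hcN t fun i => coords S (z t i)
      have h3 := ht fun h' => h ⟨i₀, h'⟩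
      have h4 := norm_le_pi_norm (fun i => coords S (z t i)) i₀
      rw [div_lt_iff₀ hc] at h3
      have h5 := mul_le_mul_of_nonneg_left h4 hc.le
      have h6 := h2.trans h1
      linarith
  · have hne (i : I) : z t₀ i ≠ ∞ := fun h => h₀ ⟨i, h⟩
    have hZ : ContinuousAt Z t₀ := by
      refine IsInducing.subtypeVal.continuousAt_iff.2 (IsInducing.subtypeVal.continuousAt_iff.2
        (continuousAt_pi.2 fun a => ?_))
      refine ContinuousAt.comp (f := fun t => (t, fun i => coords S (z t i)))
        (g := fun q : T × (I → S → ℂ) => (f q.1).toLinearMap (fun i => extend S (q.2 i)) a)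
        (hfam.2 a).continuousAt ?_
      exact continuousAt_id.prodMk (continuousAt_pi.2 fun i =>
        ContinuousAt.comp (f := fun t => z t i) (continuousAt_coords (hne i))
          (hzc i).continuousAt)
    have hev : ∀ᶠ t in 𝓝 t₀, r t = Z t := by
      have h1 : ∀ᶠ t in 𝓝 t₀, ∀ i, z t i ≠ ∞ := Filter.eventually_all.2 fun i =>
        (hzc i).continuousAt.eventually (OnePoint.isClosed_infty.isOpen_compl.mem_nhds (hne i))
      filter_upwards [h1] with t ht
      exact if_neg fun ⟨i, hi⟩ => ht i hi
    exact (ContinuousAt.congr (OnePoint.continuous_coe.continuousAt.comp hZ)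
      (hev.mono fun _ h => h.symm))

end SInfty

theorem mainTheorem2 {G : Type u} [Group G] [TopologicalSpace G] [IsTorus G]
    (K : Subgroup G) (hK : IsConnected (K : Set G)) :
    IsEInftyGAlgebra (sphereInfty K) :=
  ⟨linearOperad G (freeIndex K), linearOperad_isEInftyG hK, ⟨
    { act := fun f y => SInfty.act f y
      kcontinuous_act := .of_comp fun _ _ _ _ _ hp => SInfty.continuous_act
        (LinearOperation.isFamily_of_continuous (continuous_fst.comp hp))
        fun i => (continuous_apply i).comp (continuous_snd.comp hp)
      act_pt := fun f _ i h => SInfty.act_of_infPt f ⟨i, h⟩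
      act_smul := fun g f y => SInfty.act_smul g f y
      act_relabel := fun e f y => SInfty.act_relabel e f y
      act_one := fun y => SInfty.act_one y
      act_comp := fun f g y => SInfty.act_comp f g y }⟩⟩
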